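/- Let $\Theta\subset\mathbb R$ be compact with $|\beta|<1$ for all $\beta\in\Theta$, let $\beta_0$ be an interior point of $\Theta$, and let $(\varepsilon_t)_{t\in\mathbb Z}$ be i.i.d. random variables on a probability space $(\Omega,\mathcal F,\mathbb P)$ whose law has a strictly positive Lebesgue density on $\mathbb R$, with $\mathbb E[\varepsilon_t]=0$ and $\mathbb E[\varepsilon_t^4]<\infty$. Let $(X_t)_{t\in\mathbb Z}$ be a causal AR(1) process: $X_t=\beta_0X_{t-1}+\varepsilon_t$ a.s. for all $t\in\mathbb Z$, and there are $\vartheta_j$ with $\sum_{j\ge0}|\vartheta_j|<\infty$ and $X_t=\sum_{j\ge 0}\vartheta_j\varepsilon_{t-j}$ a.s. for all $t$. Write $\mathbf X_{1:T}=(X_1,\dots,X_T)$, $$\hat\beta(\mathbf X_{1:T})=\sum_{t=2}^TX_tX_{t-1}\Big/\sum_{t=2}^TX_{t-1}^2,\qquad \hat\sigma^2_\beta(\mathbf X_{1:T})=1-\hat\beta(\mathbf X_{1:T})^2,\qquad \sigma_\beta^2=1-\beta_0^2,$$ and let the prediction function be the conditional mean $\psi(x_0,x_1,\dots;\beta)=\beta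 x_0$, so that $\psi(X_T,X_{T-1},\dots;\beta_0)=\beta_0X_T$. Put $m_T=\sqrt T$ and $l_T=\log T$. Then the following hold as $T\to\infty$. **(General assumptions.)** (a) $m_T(\hat\beta(\mathbf X_{1:T})-\beta_0)\to N(0,\sigma_\beta^2)$ in distribution. (b) For every $x$, $\psi(x;\cdot)$ is continuous on $\Theta$ and twice differentiable on its interior. (c) $|\partial_\beta\psi(X_T,X_{T-1},\dots;\beta_0)|=O_p(1)$. (d), (e) Let $(s_t)$ and $(c_t)$ be arbitrary real sequences, and let $\psi^s_{T+1}(\mathbf X^c_{t_1:T};\beta)=\psi(X_T,\dots,X_{t_1},c_{t_1-1},\dots,c_1,s_0,s_{-1},\dots;\beta)$. There is an open neighbourhood $V\subseteq\Theta$ of $\beta_0$ with $\sup_{\beta\in V}|\partial^2_\beta\psi(X_T,X_{T-1},\dots;\beta)|=O_p(1)$ such that, for all $t_1=t_1(T)\ge1$ with $(T-t_1)/l_T\to\infty$, the three quantities $m_T\big(\psi^s_{T+1}(\mathbf X^c_{t_1:T};\beta_0)-\psi(X_T,X_{T-1},\dots;\beta_0)\big)$, $\ \big|\partial_\beta\psi^s_{T+1}(\mathbf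 X^c_{t_1:T};\beta_0)-\partial_\beta\psi(X_T,X_{T-1},\dots;\beta_0)\big|$ and $\sup_{\beta\in V}\big|\partial^2_\beta\psi^s_{T+1}(\mathbf X^c_{t_1:T};\beta)-\partial^2_\beta\psi(X_T,X_{T-1},\dots;\beta)\big|$ are $o_p(1)$. **(Two independent processes.)** After an enlargement of the probability space (that is, on a probability space with a measure-preserving map onto $\Omega$, along which $\varepsilon$ and $X$ are pulled back and still form such a model) there is a process $(Y_t)_{t\in\mathbb Z}$ distributed as $(X_t)$ and independent of $(X_t)$. **(Sample split.)** Call $T_E,T_P:\mathbb N\to\mathbb N$ *admissible* if $T_E(T)<T_P(T)$ for all $T$, $(T-T_P(T))/l_T\to\infty$ and $m_{T_E(T)}/m_T\to1$. For all $0<a<b<1$ there are admissible $T_E,T_P$ with $T_E(T)=T-\lfloor T^b\rfloor$ and $T_P(T)=T-\lfloor T^a\rfloor$ for all large $T$. The process $(X_t)$ is strictly stationary. For all admissible $T_E,T_P$ and every bounded Lipschitz $h:\mathbb R\to\mathbb R$, $$\int h\,dG_{T}(\cdot\mid X_t:T_P\le t\le T)-\int h\,dG_{T}\to0\quad\text{in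 probability},$$ where $G_T$ is the law of $m_{T_E}(\hat\beta(\mathbf X_{1:T_E})-\beta_0)$ and $G_T(\cdot\mid X_t:T_P\le t\le T)$ is its regular conditional law given $(X_t:T_P\le t\le T)$. **(CDF estimator and normality.)** $\hat\sigma_\beta^2(\mathbf X_{1:T})\to\sigma_\beta^2$ in probability, and the random law $\hat G_T=N\big(0,\max\{\hat\sigma_\beta^2(\mathbf X_{1:T}),0\}\big)$ satisfies $\int h\,d\hat G_T\to\int h\,dN(0,\sigma^2_\beta)$ in probability for every bounded Lipschitz $h:\mathbb R\to\mathbb R$. **(Variances bounded away from zero.)** The law of $X_t$ has no atoms. The estimated variances $\hat\upsilon^{2IP}_T=X_T^2\,\hat\sigma_\beta^2(\mathbf X_{1:T})$ and, for all admissible $T_E,T_P$, $\hat\upsilon^{SPL}_T=X_T^2\,\hat\sigma_\beta^2(\mathbf X_{1:T_E})$ are bounded away from zero in probability: for every $\delta>0$ there is $\eta>0$ such that $\mathbb P[\hat\upsilon_T\ge\eta]\ge1-\delta$ for all large $T$. -/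

import Mathlib

open MeasureTheory ProbabilityTheory Filter Topology
open scoped ENNReal NNReal

universe u

noncomputable section

namespace TimeSeriesPrediction

/-! ## Stochastic order symbols -/

section
variable {Ω : Type u} [MeasurableSpace Ω]

/-- `Z_T = O_p(1)` for `[0, ∞]`-valued `Z_T` (norms, or suprema of norms): for every `δ > 0` there
is a finite `M` with `P(Z_T > M) ≤ δ` for all large `T`. -/
def IsBigOp (μ : Measure Ω) (Z : ℕ → Ω → ℝ≥0∞) : Prop :=
  ∀ δ : ℝ≥0∞, 0 < δ → ∃ M : ℝ≥0, ∀ᶠ T in atTop, μ {ω | (M : ℝ≥0∞) < Z T ω} ≤ δ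

/-- `Z_T = o_p(1)` for `[0, ∞]`-valued `Z_T`: for every `η > 0`, `P(Z_T ≥ η) → 0`. -/
def IsLittleOp (μ : Measure Ω) (Z : ℕ → Ω → ℝ≥0∞) : Prop :=
  ∀ η : ℝ≥0∞, 0 < η → Tendsto (fun T => μ {ω | η ≤ Z T ω}) atTop (𝓝 0)

/-- `Z_T` is bounded away from zero in probability: for every `δ > 0` there is `η > 0` with
`P(Z_T ≥ η) ≥ 1 - δ` for all large `T`. -/
def BoundedAwayFromZeroInProb (μ : Measure Ω) (Z : ℕ → Ω → ℝ) : Prop :=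
  ∀ δ : ℝ, 0 < δ → ∃ η : ℝ, 0 < η ∧ ∀ᶠ T in atTop, 1 - δ ≤ μ.real {ω | η ≤ Z T ω}

/-! ## Samples and pasts of a process `X : ℤ → Ω → ℝ` -/

/-- The sample `X_{1:T} = (X_1, …, X_T)`; entry `i : Fin T` is `X_{i+1}`. -/
def sample (X : ℤ → Ω → ℝ) (T : ℕ) (ω : Ω) : Fin T → ℝ := fun i => X ((i : ℕ) + 1) ω

/-- The whole past `(X_T, X_{T-1}, …)`; entry `j` is `X_{T-j}`. -/
def past (X : ℤ → Ω → ℝ) (T : ℕ) (ω : Ω) : ℕ → ℝ := fun j => X ((T : ℤ) - j) ω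

/-- The approximated past `(X_T, …, X_{t₁}, c_{t₁-1}, …, c_1, s_0, s_{-1}, …)`; entry `j` has
time index `T - j`. -/
def approxPast (X : ℤ → Ω → ℝ) (s c : ℤ → ℝ) (t₁ T : ℕ) (ω : Ω) : ℕ → ℝ := fun j =>
  if (t₁ : ℤ) ≤ (T : ℤ) - j then X ((T : ℤ) - j) ω
  else if 1 ≤ (T : ℤ) - j then c ((T : ℤ) - j)
  else s ((T : ℤ) - j)

/-- The block `(X_t : a ≤ t ≤ b)`. -/
def block (X : ℤ → Ω → ℝ) (a b : ℕ) (ω : Ω) : Set.Icc (a : ℤ) (b : ℤ) → ℝ := fun t => X t ω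

/-- Strict stationarity: all time shifts of the process have the same law on `ℝ^ℤ`. -/
def StrictlyStationary (μ : Measure Ω) (X : ℤ → Ω → ℝ) : Prop :=
  ∀ k : ℤ, IdentDistrib (fun ω t => X (t + k) ω) (fun ω t => X t ω) μ μ

/-- Bounded, real-valued Lipschitz functions on the line. -/
def BoundedLipschitz (h : ℝ → ℝ) : Prop :=
  (∃ C : ℝ, ∀ x, |h x| ≤ C) ∧ ∃ K : ℝ≥0, LipschitzWith K h

/-! ## The high-level assumptions, for a scalar parameter (`r = 1`)

`ψ x θ` is the prediction function at the past `x = (x_0, x_1, …) = (X_T, X_{T-1}, …)` and the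
parameter `θ`; `θhat T` is the estimator as a function of a sample of size `T`; `m` is the
normalizing sequence and `l` the memory sequence. Distribution functions on the line are
represented by their laws. -/

/-- General assumptions: estimator, differentiability, gradient, Hessian, initial condition. -/
structure GeneralAssumptions (μ : Measure Ω) [IsProbabilityMeasure μ] (X : ℤ → Ω → ℝ)
    (Θ : Set ℝ) (θ₀ : ℝ) (ψ : (ℕ → ℝ) → ℝ → ℝ) (θhat : (T : ℕ) → (Fin T → ℝ) → ℝ)
    (m l : ℕ → ℝ) (Ginf : Measure ℝ) [IsProbabilityMeasure Ginf] (s c : ℤ → ℝ) : Prop where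
  mem : θ₀ ∈ Θ
  m_tendsto : Tendsto m atTop atTop
  l_tendsto : Tendsto l atTop atTop
  estimator : TendstoInDistribution
    (fun (T : ℕ) ω => m T * (θhat T (sample X T ω) - θ₀)) atTop (id : ℝ → ℝ) (fun _ => μ) Ginf
  continuousOn : ∀ x, ContinuousOn (ψ x) Θ
  differentiableOn : ∀ x, DifferentiableOn ℝ (ψ x) (interior Θ)
  twice_differentiableOn : ∀ x, DifferentiableOn ℝ (deriv (ψ x)) (interior Θ)
  gradient : IsBigOp μ (fun T ω => ‖deriv (ψ (past X T ω)) θ₀‖ₑ)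
  hessian_and_initial : ∃ V : Set ℝ, IsOpen V ∧ θ₀ ∈ V ∧ V ⊆ Θ ∧
    IsBigOp μ (fun T ω => ⨆ θ ∈ V, ‖iteratedDeriv 2 (ψ (past X T ω)) θ‖ₑ) ∧
    ∀ t₁ : ℕ → ℕ, (∀ T, 1 ≤ t₁ T) →
      Tendsto (fun T : ℕ => ((T : ℝ) - t₁ T) / l T) atTop atTop →
      IsLittleOp μ (fun T ω =>
        ‖m T * (ψ (approxPast X s c (t₁ T) T ω) θ₀ - ψ (past X T ω) θ₀)‖ₑ) ∧
      IsLittleOp μ (fun T ω =>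
        ‖deriv (ψ (approxPast X s c (t₁ T) T ω)) θ₀ - deriv (ψ (past X T ω)) θ₀‖ₑ) ∧
      IsLittleOp μ (fun T ω => ⨆ θ ∈ V,
        ‖iteratedDeriv 2 (ψ (approxPast X s c (t₁ T) T ω)) θ
          - iteratedDeriv 2 (ψ (past X T ω)) θ‖ₑ)

/-- Two independent processes: `Y` is distributed as `X` and independent of `X`. -/
structure TwoIndependentProcesses (μ : Measure Ω) (X Y : ℤ → Ω → ℝ) : Prop where
  measurable : ∀ t, Measurable (Y t)
  identDistrib : IdentDistrib (fun ω t => Y t ω) (fun ω t => X t ω) μ μ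
  indep : IndepFun (fun ω t => Y t ω) (fun ω t => X t ω) μ

/-- Rates of the end `TE` of the estimation sample and the start `TP` of the prediction sample. -/
structure SplitRates (m l : ℕ → ℝ) (TE TP : ℕ → ℕ) : Prop where
  lt : ∀ T, TE T < TP T
  prediction : Tendsto (fun T : ℕ => ((T : ℝ) - TP T) / l T) atTop atTop
  estimation : Tendsto (fun T : ℕ => m (TE T) / m T) atTop (𝓝 1)

/-- Weak dependence: for `A_T = m_{TE} (θhat(X_{1:TE}) - θ₀)`, integrals of bounded Lipschitz
functions against the conditional law of `A_T` given `(X_t : TP ≤ t ≤ T)` merge in probability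
with those against the unconditional law of `A_T`. -/
def WeakDependence (μ : Measure Ω) [IsProbabilityMeasure μ] (X : ℤ → Ω → ℝ) (θ₀ : ℝ)
    (θhat : (T : ℕ) → (Fin T → ℝ) → ℝ) (m : ℕ → ℝ) (TE TP : ℕ → ℕ) : Prop :=
  ∀ h : ℝ → ℝ, BoundedLipschitz h →
    let A : ℕ → Ω → ℝ := fun T ω => m (TE T) * (θhat (TE T) (sample X (TE T) ω) - θ₀)
    TendstoInMeasure μ
      (fun T ω =>
        (∫ y, h y ∂(condDistrib (A T) (block X (TP T) T) μ (block X (TP T) T ω)))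
          - ∫ y, h y ∂(μ.map (A T)))
      atTop (fun _ => 0)

/-- Assumptions on the sample-split estimator. -/
structure SplitEstimatorAssumptions (μ : Measure Ω) [IsProbabilityMeasure μ] (X : ℤ → Ω → ℝ)
    (θ₀ : ℝ) (θhat : (T : ℕ) → (Fin T → ℝ) → ℝ) (m l : ℕ → ℝ) (TE TP : ℕ → ℕ) : Prop where
  rates : SplitRates m l TE TP
  stationary : StrictlyStationary μ X
  weakDependence : WeakDependence μ X θ₀ θhat m TE TP

/-- Assumption on the estimator `Ghat T (X_{1:T})` of the limit law: it is a random probability law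
on the line that converges to `Ginf` in probability against bounded Lipschitz functions. -/
structure CdfEstimatorAssumption (μ : Measure Ω) (X : ℤ → Ω → ℝ)
    (Ghat : (T : ℕ) → (Fin T → ℝ) → Measure ℝ) (Ginf : Measure ℝ) : Prop where
  measurable : ∀ T, Measurable (Ghat T)
  isProbabilityMeasure : ∀ T x, IsProbabilityMeasure (Ghat T x)
  tendsto : ∀ h : ℝ → ℝ, BoundedLipschitz h →
    TendstoInMeasure μ (fun T ω => ∫ y, h y ∂(Ghat T (sample X T ω))) atTop
      (fun _ => ∫ y, h y ∂Ginf)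

/-- Normality: `Ginf = N(0, Υ₀)` and `Υhat(X_{1:T}) → Υ₀` in probability. -/
structure NormalityAssumption (μ : Measure Ω) (X : ℤ → Ω → ℝ) (Ginf : Measure ℝ) (Υ₀ : ℝ≥0)
    (Υhat : (T : ℕ) → (Fin T → ℝ) → ℝ) : Prop where
  normal : Ginf = gaussianReal 0 Υ₀
  measurable : ∀ T, Measurable (Υhat T)
  tendsto : TendstoInMeasure μ (fun T ω => Υhat T (sample X T ω)) atTop (fun _ => (Υ₀ : ℝ))

/-! ## The causal AR(1) model -/

/-- The causal AR(1) model `X_t = β₀ X_{t-1} + ε_t`, `t ∈ ℤ`, with parameter set `Θ`. -/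
structure AR1Model (μ : Measure Ω) (Θ : Set ℝ) (β₀ : ℝ) (ε X : ℤ → Ω → ℝ) : Prop where
  compact : IsCompact Θ
  mem_interior : β₀ ∈ interior Θ
  abs_lt_one : ∀ β ∈ Θ, |β| < 1
  innov_measurable : ∀ t, Measurable (ε t)
  innov_indep : iIndepFun ε μ
  innov_identDistrib : ∀ t, IdentDistrib (ε t) (ε 0) μ μ
  innov_density : ∃ f : ℝ → ℝ, Measurable f ∧ (∀ x, 0 < f x) ∧
    μ.map (ε 0) = volume.withDensity (fun x => ENNReal.ofReal (f x))
  innov_mean : ∫ ω, ε 0 ω ∂μ = 0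
  innov_fourth_moment : Integrable (fun ω => ε 0 ω ^ 4) μ
  measurable : ∀ t, Measurable (X t)
  recursion : ∀ t : ℤ, ∀ᵐ ω ∂μ, X t ω = β₀ * X (t - 1) ω + ε t ω
  /-- Causality: `X_t` is an absolutely summable moving average of present and past innovations. -/
  causal : ∃ ϑ : ℕ → ℝ, Summable (fun j => |ϑ j|) ∧
    ∀ t : ℤ, ∀ᵐ ω ∂μ, HasSum (fun j : ℕ => ϑ j * ε (t - j) ω) (X t ω)

/-- The conditional mean `ψ(x_0, x_1, …; β) = β x_0`, that is `β X_T` at the past of time `T`. -/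
def ar1Mean (x : ℕ → ℝ) (β : ℝ) : ℝ := β * x 0

/-- The OLS estimator `(∑_{t=2}^T x_t x_{t-1}) / (∑_{t=2}^T x_{t-1}²)`. -/
def olsEstimator : (T : ℕ) → (Fin T → ℝ) → ℝ
  | 0, _ => 0
  | n + 1, x => (∑ i : Fin n, x i.succ * x i.castSucc) / ∑ i : Fin n, x i.castSucc ^ 2

/-- The variance estimator `1 - βhat²`. -/
def olsVariance (T : ℕ) (x : Fin T → ℝ) : ℝ := 1 - olsEstimator T x ^ 2

/-- The estimated limit law `N(0, 1 - βhat²)`, the variance being truncated at `0` where `1 - βhat²`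
is negative. -/
def olsLaw (T : ℕ) (x : Fin T → ℝ) : Measure ℝ := gaussianReal 0 (olsVariance T x).toNNReal

end

/-- The OLS estimator of the sample `X_{1:T}`, written with the time indices of the process. -/
theorem olsEstimator_sample {Ω : Type u} (X : ℤ → Ω → ℝ) (T : ℕ) (ω : Ω) :
    olsEstimator T (sample X T ω) =
      (∑ t ∈ Finset.Icc 2 T, X t ω * X ((t : ℤ) - 1) ω) /
        ∑ t ∈ Finset.Icc 2 T, X ((t : ℤ) - 1) ω ^ 2 := by
  cases T with
  | zero => simp [olsEstimator]
  | succ n =>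
    have key : ∀ g : ℕ → ℝ, ∑ t ∈ Finset.Icc 2 (n + 1), g t = ∑ i : Fin n, g (i + 2) := by
      intro g
      rw [Fin.sum_univ_eq_sum_range (fun i => g (i + 2)) n, Finset.range_eq_Ico,
        Finset.sum_Ico_add' g 0 n 2]
      rfl
    rw [key (fun t => X t ω * X ((t : ℤ) - 1) ω), key (fun t => X ((t : ℤ) - 1) ω ^ 2)]
    simp only [olsEstimator, sample]
    congr 1 <;> refine Finset.sum_congr rfl fun i _ => ?_
    · congr 2 <;> (push_cast [Fin.val_succ, Fin.val_castSucc]; ring)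
    · congr 2; push_cast [Fin.val_castSucc]; ring

end TimeSeriesPrediction

end

set_option linter.unusedSectionVars false

namespace TimeSeriesPrediction

/-! ## Characteristic functions with finite third moment -/

/-! Everything rests on two features of the model. By causality `X` is the same function of the
shifted innovations at every time, hence strictly stationary, and the past up to time `n` is
independent of the innovations after `n`. By the recursion, the estimation error for `n + 1`
observations is the ratio `scoreSum / squareSum`, that is `∑ X_{i+1} ε_{i+2}` over `∑ X_{i+1}²`.

Consistency and normality. Put `γ = E X_0²` and `v = E ε_0² = (1 - β₀²) γ`. No ergodic theorem is
used: squaring and telescoping the recursion (`ae_squareSum_eq`) expresses `squareSum` through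
boundary terms, the score and `∑ ε²`, and second moments then give `squareSum / n → γ`. The score is
a sum of predictable weights times independent innovations. Its central limit theorem
(`tendstoInDistribution_sum_mul`) follows by integrating the innovations out one at a time from
`exp(i S + v V / 2)`, with `S` the weighted sum and `V` the sum of squared weights, truncated so
that `V` stays bounded. Slutsky's argument gives the limit variance `γ⁻² v γ = 1 - β₀²`.

Weak dependence. Admissible splits guarantee no growing gap between the estimation sample and the
later block. A gap is created by dropping the last `k` observations from the estimator, which
changes the normalized error by `o_p(1)` (`tendstoInMeasure_olsError_add_sub`). Across a gap of
length `j`, the past acts on the block only through the shift `β₀^j X_n`, added to an innovation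
that has a density. Translation is continuous in `L¹`, so a small shift is invisible to bounded
measurable functions of the block (`abs_covariance_shift_le`). The mean deviation of the conditional
law is a covariance with a sign function, to which this bound applies.

The rest is soft. The prediction function is linear in the parameter and reads only the newest
observation, so initial conditions drop out exactly once `t₁ ≤ T`. The variance estimators are
continuous images of the least squares estimator. Finally `X_T²` has a fixed law without mass at
zero. -/

theorem norm_exp_mul_I_sub_quadratic_le (x : ℝ) :
    ‖Complex.exp (x * Complex.I) - (1 + x * Complex.I - x ^ 2 / 2)‖ ≤ 4 * |x| ^ 3 := by
  have hI : (x * Complex.I) ^ 2 = -(x : ℂ) ^ 2 := by rw [mul_pow, Complex.I_sq]; ring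
  rcases le_total |x| 1 with h | h
  · have hx : ‖(x * Complex.I : ℂ)‖ = |x| := by simp
    have := Complex.exp_bound (x := x * Complex.I) (hx.trans_le h) (n := 3) (by norm_num)
    rw [hx] at this
    simp only [Finset.sum_range_succ, Finset.sum_range_zero, hI] at this
    norm_num [Nat.factorial] at this
    have e : Complex.exp (x * Complex.I) - (1 + x * Complex.I - x ^ 2 / 2)
        = Complex.exp (x * Complex.I) - (1 + x * Complex.I + -(x : ℂ) ^ 2 / 2) := by ring
    rw [e]
    refine this.trans ?_
    have : 0 ≤ |x| ^ 3 := by positivity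
    linarith
  · have h1 : ‖Complex.exp (x * Complex.I)‖ = 1 := Complex.norm_exp_ofReal_mul_I x
    have h2 : ‖(x * Complex.I : ℂ)‖ = |x| := by simp
    have h3 : ‖((x : ℂ) ^ 2 / 2)‖ = |x| ^ 2 / 2 := by simp
    have h4 := norm_sub_le (Complex.exp (x * Complex.I)) (1 + x * Complex.I - x ^ 2 / 2)
    have h5 := norm_sub_le (1 + x * Complex.I) ((x : ℂ) ^ 2 / 2)
    have h6 := norm_add_le (1 : ℂ) (x * Complex.I)
    rw [norm_one] at h6
    have h7 : |x| ≤ |x| ^ 3 := le_self_pow₀ h (by norm_num)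
    have h8 : |x| ^ 2 ≤ |x| ^ 3 := pow_le_pow_right₀ h (by norm_num)
    linarith

theorem abs_exp_neg_sub_le {y : ℝ} (hy : 0 ≤ y) : |Real.exp (-y) - (1 - y)| ≤ y ^ 2 := by
  have h1 : 1 - y ≤ Real.exp (-y) := by linarith [Real.add_one_le_exp (-y)]
  have h2 : Real.exp (-y) ≤ (1 + y)⁻¹ := by
    rw [Real.exp_neg]
    gcongr
    linarith [Real.add_one_le_exp y]
  have h3 : (1 + y)⁻¹ - (1 - y) ≤ y ^ 2 := by
    have : (1 + y)⁻¹ - (1 - y) = y ^ 2 * (1 + y)⁻¹ := by field_simp; ring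
    rw [this]
    exact mul_le_of_le_one_right (by positivity) (inv_le_one_of_one_le₀ (by linarith))
  rw [abs_of_nonneg (by linarith)]
  linarith

/-- Both functions differ from `1 - v u² / 2` by a cubic error when `|u| ≤ 1`; for `|u| ≥ 1` both
have modulus at most one, which the summand `2` of the constant absorbs. Uniformity in `u` matters
because the bound is later used at a random frequency. -/
theorem exists_norm_charFun_sub_exp_le {ν : Measure ℝ} [IsProbabilityMeasure ν]
    (h3 : MemLp id 3 ν) (h0 : ∫ x, x ∂ν = 0) :
    ∃ C : ℝ, 0 ≤ C ∧ ∀ u : ℝ,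
      ‖charFun ν u - Complex.exp ((-((∫ x, x ^ 2 ∂ν) * u ^ 2 / 2) : ℝ))‖ ≤ C * |u| ^ 3 := by
  set v := ∫ x, x ^ 2 ∂ν with hv
  have hv0 : 0 ≤ v := integral_nonneg fun x => sq_nonneg x
  have i1 : Integrable (fun x : ℝ => x) ν := (h3.mono_exponent (by norm_num)).integrable le_rfl
  have i2 : Integrable (fun x : ℝ => x ^ 2) ν :=
    (h3.mono_exponent (p := 2) (by norm_num)).integrable_sq
  have i3 : Integrable (fun x : ℝ => |x| ^ 3) ν := by
    simpa using h3.integrable_norm_pow (p := 3) (by norm_num)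
  have hK : 0 ≤ ∫ x, |x| ^ 3 ∂ν := integral_nonneg fun x => by positivity
  refine ⟨4 * (∫ x, |x| ^ 3 ∂ν) + v ^ 2 + 2, by positivity, fun u => ?_⟩
  have hu3 : 0 ≤ |u| ^ 3 := by positivity
  rcases le_total |u| 1 with hu | hu
  · have j1 : Integrable (fun x : ℝ => ((u * x : ℝ) : ℂ) * Complex.I) ν :=
      ((i1.const_mul u).ofReal).mul_const _
    have j2 : Integrable (fun x : ℝ => ((u * x : ℝ) : ℂ) ^ 2 / 2) ν := by
      have := (i2.const_mul (u ^ 2)).ofReal (𝕜 := ℂ)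
      refine (this.div_const 2).congr (ae_of_all _ fun x => ?_)
      simp [mul_pow]
    have j3 : Integrable (fun x : ℝ => 1 + ((u * x : ℝ) : ℂ) * Complex.I) ν :=
      (integrable_const _).add j1
    have j4 : Integrable
        (fun x : ℝ => 1 + ((u * x : ℝ) : ℂ) * Complex.I - ((u * x : ℝ) : ℂ) ^ 2 / 2) ν := j3.sub j2
    have e1 : ∫ x, (1 + ((u * x : ℝ) : ℂ) * Complex.I - ((u * x : ℝ) : ℂ) ^ 2 / 2) ∂ν
        = ((1 - v * u ^ 2 / 2 : ℝ) : ℂ) := by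
      rw [integral_sub j3 j2, integral_add (integrable_const _) j1,
        integral_mul_const, integral_complex_ofReal, integral_const_mul, h0]
      have : ∫ x, ((u * x : ℝ) : ℂ) ^ 2 / 2 ∂ν = ((v * u ^ 2 / 2 : ℝ) : ℂ) := by
        rw [hv, ← integral_mul_const, ← integral_div, ← integral_complex_ofReal]
        congr 1; ext x; push_cast; ring
      rw [this]; simp
    have e2 : ‖charFun ν u - ((1 - v * u ^ 2 / 2 : ℝ) : ℂ)‖ ≤ 4 * (∫ x, |x| ^ 3 ∂ν) * |u| ^ 3 := by
      have j0 : Integrable (fun x : ℝ => Complex.exp (((u * x : ℝ) : ℂ) * Complex.I)) ν := by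
        refine Integrable.of_bound (by fun_prop) 1 (ae_of_all _ fun x => ?_)
        exact (Complex.norm_exp_ofReal_mul_I _).le
      have : charFun ν u = ∫ x, Complex.exp (((u * x : ℝ) : ℂ) * Complex.I) ∂ν := by
        rw [charFun_apply_real]; simp
      rw [this, ← e1, ← integral_sub j0 j4]
      refine (norm_integral_le_integral_norm _).trans ?_
      have : 4 * (∫ x, |x| ^ 3 ∂ν) * |u| ^ 3 = ∫ x, 4 * |u| ^ 3 * |x| ^ 3 ∂ν := by
        rw [integral_const_mul]; ring
      rw [this]
      refine integral_mono_of_nonneg (ae_of_all _ fun x => norm_nonneg _) (i3.const_mul _)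
        (ae_of_all _ fun x => ?_)
      refine (norm_exp_mul_I_sub_quadratic_le (u * x)).trans_eq ?_
      rw [abs_mul]; ring
    have e3 : ‖((1 - v * u ^ 2 / 2 : ℝ) : ℂ) - Complex.exp ((-(v * u ^ 2 / 2) : ℝ))‖
        ≤ v ^ 2 * |u| ^ 3 := by
      rw [← Complex.ofReal_exp, ← Complex.ofReal_sub, Complex.norm_real, Real.norm_eq_abs,
        abs_sub_comm]
      refine (abs_exp_neg_sub_le (by positivity)).trans ?_
      have h4 : |u| ^ 4 ≤ |u| ^ 3 := pow_le_pow_of_le_one (abs_nonneg u) hu (by norm_num)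
      have : (v * u ^ 2 / 2) ^ 2 = v ^ 2 * |u| ^ 4 / 4 := by
        rw [show |u| ^ 4 = (|u| ^ 2) ^ 2 by ring, sq_abs]; ring
      rw [this]
      nlinarith [sq_nonneg v, mul_le_mul_of_nonneg_left h4 (sq_nonneg v),
        mul_nonneg (sq_nonneg v) (by positivity : 0 ≤ |u| ^ 4)]
    calc _ ≤ _ := norm_sub_le_norm_sub_add_norm_sub _ ((1 - v * u ^ 2 / 2 : ℝ) : ℂ) _
      _ ≤ 4 * (∫ x, |x| ^ 3 ∂ν) * |u| ^ 3 + v ^ 2 * |u| ^ 3 := add_le_add e2 e3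
      _ ≤ _ := by nlinarith
  · have h1 : ‖charFun ν u‖ ≤ 1 := norm_charFun_le_one u
    have h2 : ‖Complex.exp ((-(v * u ^ 2 / 2) : ℝ))‖ ≤ 1 := by
      rw [← Complex.ofReal_exp, Complex.norm_real, Real.norm_eq_abs, Real.abs_exp,
        Real.exp_le_one_iff]
      have : 0 ≤ v * u ^ 2 / 2 := by positivity
      linarith
    have h3 : 1 ≤ |u| ^ 3 := one_le_pow₀ hu
    refine (norm_sub_le _ _).trans ?_
    nlinarith [mul_nonneg hK hu3, mul_nonneg (sq_nonneg v) hu3]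

/-! ## Integrals and independence -/

variable {Ω : Type*} [MeasurableSpace Ω] {μ : Measure Ω}

/-- Freezing: the joint law is a product, so Fubini integrates `g` out with `f` held fixed. -/
theorem integral_prodMk_of_indepFun [IsFiniteMeasure μ] {E F G : Type*} [MeasurableSpace E]
    [MeasurableSpace F] [NormedAddCommGroup G] [NormedSpace ℝ G] {f : Ω → E} {g : Ω → F}
    (hf : Measurable f) (hg : Measurable g) (hfg : IndepFun f g μ) {k : E × F → G}
    (hk : StronglyMeasurable k) (hki : Integrable (fun ω => k (f ω, g ω)) μ) :
    ∫ ω, k (f ω, g ω) ∂μ = ∫ ω, (∫ y, k (f ω, y) ∂(μ.map g)) ∂μ := by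
  have hmap := (indepFun_iff_map_prod_eq_prod_map_map hf.aemeasurable hg.aemeasurable).1 hfg
  have hint : Integrable k ((μ.map f).prod (μ.map g)) := by
    rw [← hmap, integrable_map_measure hk.aestronglyMeasurable (hf.prodMk hg).aemeasurable]
    exact hki
  calc ∫ ω, k (f ω, g ω) ∂μ = ∫ p, k p ∂(μ.map fun ω => (f ω, g ω)) :=
        (integral_map (hf.prodMk hg).aemeasurable hk.aestronglyMeasurable).symm
    _ = ∫ x, (∫ y, k (x, y) ∂(μ.map g)) ∂(μ.map f) := by rw [hmap, integral_prod _ hint]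
    _ = _ := integral_map hf.aemeasurable hk.integral_prod_right'.aestronglyMeasurable

theorem integral_mul_exp_of_indepFun [IsProbabilityMeasure μ] {P : Ω → ℂ} {W e : Ω → ℝ}
    (hP : Measurable P) (hW : Measurable W) (he : Measurable e) {B : ℝ} (hB : ∀ ω, ‖P ω‖ ≤ B)
    (hind : IndepFun (fun ω => (P ω, W ω)) e μ) :
    ∫ ω, P ω * Complex.exp ((W ω * e ω : ℝ) * Complex.I) ∂μ
      = ∫ ω, P ω * charFun (μ.map e) (W ω) ∂μ := by
  have := integral_prodMk_of_indepFun (hP.prodMk hW) he hind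
    (k := fun p : (ℂ × ℝ) × ℝ => p.1.1 * Complex.exp ((p.1.2 * p.2 : ℝ) * Complex.I))
    (Measurable.stronglyMeasurable (by fun_prop)) ?_
  · simp only at this
    rw [this]
    congr 1; ext ω
    rw [integral_const_mul, charFun_apply_real]
    simp
  · refine Integrable.of_bound (Measurable.aestronglyMeasurable (by fun_prop)) B
      (ae_of_all _ fun ω => ?_)
    rw [norm_mul, Complex.norm_exp_ofReal_mul_I, mul_one]
    exact hB ω

/-! ## Convergence in probability -/

theorem tendstoInMeasure_comp_continuousAt {E F : Type*} [PseudoMetricSpace E]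
    [PseudoMetricSpace F] {f : ℕ → Ω → E} {c : E} (hf : TendstoInMeasure μ f atTop fun _ => c)
    {g : E → F} (hg : ContinuousAt g c) :
    TendstoInMeasure μ (fun n ω => g (f n ω)) atTop fun _ => g c := by
  rw [tendstoInMeasure_iff_dist] at hf ⊢
  intro δ hδ
  obtain ⟨η, hη, h⟩ := Metric.continuousAt_iff.1 hg δ hδ
  refine tendsto_of_tendsto_of_tendsto_of_le_of_le tendsto_const_nhds (hf η hη)
    (fun _ => zero_le) fun n => measure_mono fun ω hω => ?_
  simp only [Set.mem_ofPred_eq] at hω ⊢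
  by_contra hc
  exact absurd (h (not_le.1 hc)) (not_lt.2 hω)

/-- If `|f n|` is small wherever `|g n|` is, convergence in probability carries over. -/
theorem tendstoInMeasure_of_dist_lt {E F : Type*} [PseudoMetricSpace E]
    [PseudoMetricSpace F] {f : ℕ → Ω → E} {c : Ω → E} {g : ℕ → Ω → F} {d : Ω → F}
    (hf : TendstoInMeasure μ f atTop c)
    (h : ∀ δ > 0, ∃ η > 0, ∀ᶠ n in atTop, ∀ ω, dist (f n ω) (c ω) < η → dist (g n ω) (d ω) < δ) :
    TendstoInMeasure μ g atTop d := by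
  rw [tendstoInMeasure_iff_dist] at hf ⊢
  intro δ hδ
  obtain ⟨η, hη, h⟩ := h δ hδ
  refine tendsto_of_tendsto_of_tendsto_of_le_of_le' tendsto_const_nhds (hf η hη)
    (Eventually.of_forall fun _ => zero_le) ?_
  filter_upwards [h] with n hn
  refine measure_mono fun ω hω => ?_
  simp only [Set.mem_ofPred_eq] at hω ⊢
  by_contra hc
  exact absurd (hn ω (not_le.1 hc)) (not_lt.2 hω)

theorem tendsto_integral_norm_of_tendstoInMeasure [IsProbabilityMeasure μ] {E : Type*}
    [NormedAddCommGroup E] {f : ℕ → Ω → E} (hm : ∀ n, AEStronglyMeasurable (f n) μ) {B : ℝ}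
    (hB : ∀ n ω, ‖f n ω‖ ≤ B) (hf : TendstoInMeasure μ f atTop fun _ => 0) :
    Tendsto (fun n => ∫ ω, ‖f n ω‖ ∂μ) atTop (𝓝 0) := by
  have hu : UnifIntegrable f 1 μ := by
    refine unifIntegrable_of le_rfl (by simp) hm fun ε hε => ⟨(B + 1).toNNReal, fun n => ?_⟩
    have : {x | (B + 1).toNNReal ≤ ‖f n x‖₊} = ∅ := by
      ext x
      simp only [Set.mem_ofPred_eq, Set.mem_empty_iff_false, iff_false, not_le]
      rw [← NNReal.coe_lt_coe, coe_nnnorm]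
      exact ((hB n x).trans_lt (lt_add_one B)).trans_le (Real.le_coe_toNNReal _)
    simp [this]
  have h := tendsto_Lp_finite_of_tendstoInMeasure le_rfl (by simp) hm
    (MemLp.zero (ε := E) (p := 1)) hu hf
  simp only [eLpNorm_one_eq_lintegral_enorm] at h
  have h2 := (ENNReal.tendsto_toReal ENNReal.zero_ne_top).comp h
  refine h2.congr fun n => ?_
  rw [integral_norm_eq_lintegral_enorm (hm n)]
  simp

theorem tendstoInMeasure_of_integral_norm [IsFiniteMeasure μ] {E : Type*}
    [NormedAddCommGroup E] {f : ℕ → Ω → E} (hi : ∀ n, Integrable (f n) μ)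
    (hf : Tendsto (fun n => ∫ ω, ‖f n ω‖ ∂μ) atTop (𝓝 0)) :
    TendstoInMeasure μ f atTop fun _ => 0 := by
  refine tendstoInMeasure_of_tendsto_eLpNorm (p := 1) (by simp)
    (fun n => (hi n).aestronglyMeasurable) aestronglyMeasurable_const ?_
  have h2 := (ENNReal.continuous_ofReal.tendsto 0).comp hf
  rw [ENNReal.ofReal_zero] at h2
  refine h2.congr fun n => ?_
  simp only [Function.comp, eLpNorm_one_eq_lintegral_enorm, Pi.sub_apply, sub_zero]
  rw [← ofReal_integral_norm_eq_lintegral_enorm (hi n)]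

/-! ## A central limit theorem for predictable multiples of independent innovations -/

section MartingaleCLT

variable {Ω : Type*} {m0 : MeasurableSpace Ω} {μ : Measure Ω} [IsProbabilityMeasure μ]

/-- For centred Gaussian innovations of variance `v` the integral would be exactly one. Each
induction step replaces the characteristic function of one innovation by the Gaussian one; this
costs `C |w|³`, weighted by an exponential that the bound on `∑ w²` keeps below `exp(v c / 2)`. -/
theorem norm_integral_exp_sum_sub_one_le (F : ℕ → MeasurableSpace Ω) (hle : ∀ n, F n ≤ m0)
    (hmono : Monotone F) {w e : ℕ → Ω → ℝ} (hw : ∀ i, Measurable[F i] (w i))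
    (he : ∀ i, Measurable[F (i + 1)] (e i))
    (hind : ∀ i, Indep (F i) (MeasurableSpace.comap (e i) inferInstance) μ)
    {v C c : ℝ} (hv : 0 ≤ v)
    (hC : ∀ i u, ‖charFun (μ.map (e i)) u - Complex.exp ((-(v * u ^ 2 / 2) : ℝ))‖ ≤ C * |u| ^ 3)
    (hc : ∀ m ω, ∑ i ∈ Finset.range m, w i ω ^ 2 ≤ c)
    (hint : ∀ i, Integrable (fun ω => |w i ω| ^ 3) μ) (m : ℕ) :
    ‖∫ ω, Complex.exp ((∑ i ∈ Finset.range m, w i ω * e i ω : ℝ) * Complex.I)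
        * Complex.exp ((v / 2 * ∑ i ∈ Finset.range m, w i ω ^ 2 : ℝ)) ∂μ - 1‖
      ≤ Real.exp (v * c / 2) * C * ∑ i ∈ Finset.range m, ∫ ω, |w i ω| ^ 3 ∂μ := by
  induction m with
  | zero => simp
  | succ m ih =>
    set S : Ω → ℝ := fun ω => ∑ i ∈ Finset.range m, w i ω * e i ω with hSdef
    set V : ℕ → Ω → ℝ := fun m ω => ∑ i ∈ Finset.range m, w i ω ^ 2 with hVdef
    -- The index is `V (m + 1)`, not `V m`: it is still known at time `m`. Multiplying `P` by the
    -- characteristic function of `e m` at `w m` gives the next stage after integration, and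
    -- multiplying by the Gaussian one gives the current stage.
    set P : Ω → ℂ := fun ω => Complex.exp ((S ω : ℝ) * Complex.I)
      * Complex.exp ((v / 2 * V (m + 1) ω : ℝ)) with hPdef
    have hSm : Measurable[F m] S := by
      refine Finset.measurable_fun_sum _ fun i hi => ?_
      have hi := Finset.mem_range.1 hi
      exact ((hw i).mono (hmono hi.le) le_rfl).mul ((he i).mono (hmono hi) le_rfl)
    have hVm : Measurable[F m] (V (m + 1)) := by
      refine Finset.measurable_fun_sum _ fun i hi => ?_
      have hi := Finset.mem_range_succ_iff.1 hi
      exact ((hw i).mono (hmono hi) le_rfl).pow_const 2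
    have hPm : Measurable[F m] P := by
      have : Measurable fun p : ℝ × ℝ => Complex.exp ((p.1 : ℝ) * Complex.I)
        * Complex.exp ((v / 2 * p.2 : ℝ)) := by fun_prop
      exact this.comp (hSm.prodMk hVm)
    have hPW : Measurable[F m] fun ω => (P ω, w m ω) := hPm.prodMk (hw m)
    have hem : Measurable (e m) := (he m).mono (hle _) le_rfl
    have hwm : Measurable (w m) := (hw m).mono (hle _) le_rfl
    have hPm' : Measurable P := hPm.mono (hle _) le_rfl
    have hI : IndepFun (fun ω => (P ω, w m ω)) (e m) μ :=
      indep_of_indep_of_le_left (hind m) hPW.comap_le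
    have hV0 : ∀ k ω, 0 ≤ V k ω := fun k ω => Finset.sum_nonneg fun i _ => sq_nonneg _
    have hnV : ∀ k ω, ‖Complex.exp ((v / 2 * V k ω : ℝ))‖ ≤ Real.exp (v * c / 2) := fun k ω => by
      rw [← Complex.ofReal_exp, Complex.norm_real, Real.norm_eq_abs, Real.abs_exp,
        Real.exp_le_exp]
      nlinarith [hc k ω]
    have hPB : ∀ ω, ‖P ω‖ ≤ Real.exp (v * c / 2) := fun ω => by
      rw [hPdef, norm_mul, Complex.norm_exp_ofReal_mul_I, one_mul]
      exact hnV _ _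
    have e1 : ∫ ω, Complex.exp ((∑ i ∈ Finset.range (m + 1), w i ω * e i ω : ℝ) * Complex.I)
        * Complex.exp ((v / 2 * ∑ i ∈ Finset.range (m + 1), w i ω ^ 2 : ℝ)) ∂μ
        = ∫ ω, P ω * charFun (μ.map (e m)) (w m ω) ∂μ := by
      rw [← integral_mul_exp_of_indepFun hPm' hwm hem hPB hI]
      congr 1; ext ω
      rw [Finset.sum_range_succ (fun i => w i ω * e i ω), Complex.ofReal_add, add_mul,
        Complex.exp_add]
      simp only [hPdef, hSdef, hVdef]
      ring
    have e2 : ∀ ω, Complex.exp ((S ω : ℝ) * Complex.I) * Complex.exp ((v / 2 * V m ω : ℝ))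
        = P ω * Complex.exp ((-(v * w m ω ^ 2 / 2) : ℝ)) := fun ω => by
      have : v / 2 * V m ω = v / 2 * V (m + 1) ω + -(v * w m ω ^ 2 / 2) := by
        simp only [hVdef, Finset.sum_range_succ]; ring
      rw [this, Complex.ofReal_add, Complex.exp_add]
      simp only [hPdef]
      ring
    have hI1 : Integrable (fun ω => P ω * charFun (μ.map (e m)) (w m ω)) μ := by
      have : IsProbabilityMeasure (μ.map (e m)) := Measure.isProbabilityMeasure_map hem.aemeasurable
      refine Integrable.of_bound (hPm'.mul (measurable_charFun.comp hwm)).aestronglyMeasurable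
        (Real.exp (v * c / 2)) (ae_of_all _ fun ω => ?_)
      rw [norm_mul]
      exact (mul_le_of_le_one_right (norm_nonneg _) (norm_charFun_le_one _)).trans (hPB ω)
    have hI2 : Integrable (fun ω => P ω * Complex.exp ((-(v * w m ω ^ 2 / 2) : ℝ))) μ := by
      refine Integrable.of_bound (Measurable.aestronglyMeasurable (by fun_prop))
        (Real.exp (v * c / 2)) (ae_of_all _ fun ω => ?_)
      rw [← e2, norm_mul, Complex.norm_exp_ofReal_mul_I, one_mul]
      exact hnV _ _
    have e3 : ‖∫ ω, P ω * charFun (μ.map (e m)) (w m ω) ∂μ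
        - ∫ ω, P ω * Complex.exp ((-(v * w m ω ^ 2 / 2) : ℝ)) ∂μ‖
        ≤ Real.exp (v * c / 2) * C * ∫ ω, |w m ω| ^ 3 ∂μ := by
      rw [← integral_sub hI1 hI2, ← integral_const_mul]
      refine norm_integral_le_of_norm_le ((hint m).const_mul _) (ae_of_all _ fun ω => ?_)
      rw [← mul_sub, norm_mul, mul_assoc]
      exact mul_le_mul (hPB ω) (hC m _) (norm_nonneg _) (Real.exp_nonneg _)
    rw [e1, Finset.sum_range_succ, mul_add, add_comm]
    simp only [hSdef, hVdef] at e2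
    simp only [e2] at ih
    refine (norm_sub_le_norm_sub_add_norm_sub _ _ _).trans (add_le_add e3 ih)

/-- If the last term survives, the full sum is at most `c`; otherwise the last term is zero. The
test for term `i` involves only `y_0, …, y_i`, so truncated weights remain predictable. -/
theorem sum_truncated_sq_le (y : ℕ → ℝ) {c : ℝ} (hc : 0 ≤ c) (m : ℕ) :
    ∑ i ∈ Finset.range m,
      (if ∑ j ∈ Finset.range (i + 1), y j ^ 2 ≤ c then y i else 0) ^ 2 ≤ c := by
  induction m with
  | zero => simpa using hc
  | succ m ih =>
    by_cases h : ∑ j ∈ Finset.range (m + 1), y j ^ 2 ≤ c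
    · refine le_trans (Finset.sum_le_sum fun i _ => ?_) h
      split_ifs
      · exact le_rfl
      · simpa using sq_nonneg (y i)
    · rw [Finset.sum_range_succ, if_neg h]
      simpa using ih

/-- Weights are truncated once `∑ y²` exceeds `n (q + 1)`. As `∑ y² / n → q`, this changes nothing
with probability tending to one, while it bounds the exponential correction. Replacing that
correction by its limit `exp(v q t² / 2)` yields the Gaussian characteristic function. -/
theorem tendsto_charFun_sum_mul (F : ℕ → MeasurableSpace Ω) (hle : ∀ n, F n ≤ m0)
    (hmono : Monotone F) {y e : ℕ → Ω → ℝ} (hy : ∀ i, Measurable[F i] (y i))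
    (he : ∀ i, Measurable[F (i + 1)] (e i))
    (hind : ∀ i, Indep (F i) (MeasurableSpace.comap (e i) inferInstance) μ)
    {v C M q : ℝ} (hv : 0 ≤ v) (hq : 0 ≤ q)
    (hC : ∀ i u, ‖charFun (μ.map (e i)) u - Complex.exp ((-(v * u ^ 2 / 2) : ℝ))‖ ≤ C * |u| ^ 3)
    (hint : ∀ i, Integrable (fun ω => |y i ω| ^ 3) μ) (hM : ∀ i, ∫ ω, |y i ω| ^ 3 ∂μ ≤ M)
    (hqlim : TendstoInMeasure μ (fun n ω => (∑ i ∈ Finset.range n, y i ω ^ 2) / n) atTop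
      fun _ => q) (t : ℝ) :
    Tendsto (fun n : ℕ => ∫ ω, Complex.exp
        ((t * ((√(n : ℝ))⁻¹ * ∑ i ∈ Finset.range n, y i ω * e i ω) : ℝ) * Complex.I) ∂μ) atTop
      (𝓝 (Complex.exp ((-(v * q * t ^ 2 / 2) : ℝ)))) := by
  have hC0 : 0 ≤ C := by
    have := (norm_nonneg _).trans (hC 0 1)
    simpa using this
  have hmy : ∀ i, Measurable (y i) := fun i => (hy i).mono (hle _) le_rfl
  have hme : ∀ i, Measurable (e i) := fun i => (he i).mono (hle _) le_rfl
  set r : ℕ → ℝ := fun n => t * (√(n : ℝ))⁻¹ with hr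
  set w : ℕ → ℕ → Ω → ℝ := fun n i ω =>
    r n * (if ∑ j ∈ Finset.range (i + 1), y j ω ^ 2 ≤ n * (q + 1) then y i ω else 0) with hw
  set c : ℝ := t ^ 2 * (q + 1) with hcdef
  have hc0 : 0 ≤ c := by positivity
  have hr2 : ∀ n : ℕ, r n ^ 2 * n ≤ t ^ 2 := fun n => by
    rw [hr, mul_pow, inv_pow, Real.sq_sqrt (Nat.cast_nonneg n), mul_assoc]
    exact mul_le_of_le_one_right (sq_nonneg t) (inv_mul_le_one_of_le₀ le_rfl (Nat.cast_nonneg n))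
  have hwm : ∀ n i, Measurable[F i] (w n i) := fun n i => by
    refine Measurable.const_mul (Measurable.ite (measurableSet_le ?_ measurable_const) (hy i)
      measurable_const) _
    refine Finset.measurable_fun_sum _ fun j hj => ?_
    exact ((hy j).mono (hmono (Finset.mem_range_succ_iff.1 hj)) le_rfl).pow_const 2
  have hwc : ∀ n m ω, ∑ i ∈ Finset.range m, w n i ω ^ 2 ≤ c := fun n m ω => by
    simp only [hw, mul_pow, ← Finset.mul_sum]
    have := sum_truncated_sq_le (fun i => y i ω) (c := n * (q + 1)) (by positivity) m
    calc _ ≤ r n ^ 2 * (n * (q + 1)) := mul_le_mul_of_nonneg_left this (sq_nonneg _)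
      _ = r n ^ 2 * n * (q + 1) := by ring
      _ ≤ _ := mul_le_mul_of_nonneg_right (hr2 n) (by linarith)
  have hwy : ∀ n i ω, |w n i ω| ^ 3 ≤ |r n| ^ 3 * |y i ω| ^ 3 := fun n i ω => by
    simp only [hw, abs_mul, mul_pow]
    refine mul_le_mul_of_nonneg_left ?_ (by positivity)
    split_ifs
    · exact le_rfl
    · simp
  have hwi : ∀ n i, Integrable (fun ω => |w n i ω| ^ 3) μ := fun n i => by
    refine ((hint i).const_mul (|r n| ^ 3)).mono'
      ((((hwm n i).mono (hle _) le_rfl).abs).pow_const 3).aestronglyMeasurable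
      (ae_of_all _ fun ω => ?_)
    rw [Real.norm_of_nonneg (by positivity)]
    exact hwy n i ω
  set S' : ℕ → Ω → ℝ := fun n ω => ∑ i ∈ Finset.range n, w n i ω * e i ω with hS'
  set V' : ℕ → Ω → ℝ := fun n ω => ∑ i ∈ Finset.range n, w n i ω ^ 2 with hV'
  set Z : ℕ → Ω → ℂ := fun n ω => Complex.exp ((S' n ω : ℝ) * Complex.I)
    * Complex.exp ((v / 2 * V' n ω : ℝ)) with hZ
  set a : ℝ := v * q * t ^ 2 / 2 with ha
  set Y : ℕ → Ω → ℂ := fun n ω => Complex.exp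
        ((t * ((√(n : ℝ))⁻¹ * ∑ i ∈ Finset.range n, y i ω * e i ω) : ℝ) * Complex.I) with hY
  have hS'm : ∀ n, Measurable (S' n) := fun n => Finset.measurable_fun_sum _ fun i _ =>
    ((hwm n i).mono (hle _) le_rfl).mul (hme i)
  have hV'm : ∀ n, Measurable (V' n) := fun n => Finset.measurable_fun_sum _ fun i _ =>
    ((hwm n i).mono (hle _) le_rfl).pow_const 2
  have hYm : ∀ n, Measurable (Y n) := fun n => by fun_prop
  have hZm : ∀ n, Measurable (Z n) := fun n => by
    have := hS'm n
    have := hV'm n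
    fun_prop
  have hZB : ∀ n ω, ‖Z n ω‖ ≤ Real.exp (v / 2 * c) := fun n ω => by
    rw [hZ, norm_mul, Complex.norm_exp_ofReal_mul_I, one_mul, ← Complex.ofReal_exp,
      Complex.norm_real, Real.norm_eq_abs, Real.abs_exp, Real.exp_le_exp]
    exact mul_le_mul_of_nonneg_left (hwc n n ω) (by positivity)
  -- the truncated exponential martingale has mean close to one
  have h1 : Tendsto (fun n => ∫ ω, Z n ω ∂μ) atTop (𝓝 1) := by
    rw [tendsto_iff_norm_sub_tendsto_zero]
    -- The error is a sum of `n` terms, each of order `|t|³ M n^(-3/2)`.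
    have hlim : Tendsto (fun n : ℕ => Real.exp (v * c / 2) * C * (|t| ^ 3 * M * (√(n : ℝ))⁻¹)) atTop
        (𝓝 0) := by
      have : Tendsto (fun n : ℕ => (√(n : ℝ))⁻¹) atTop (𝓝 0) :=
        tendsto_inv_atTop_zero.comp (Real.tendsto_sqrt_atTop.comp tendsto_natCast_atTop_atTop)
      simpa using (this.const_mul (|t| ^ 3 * M)).const_mul (Real.exp (v * c / 2) * C)
    refine squeeze_zero (fun n => norm_nonneg _) (fun n => ?_) hlim
    refine (norm_integral_exp_sum_sub_one_le F hle hmono (hwm n) he hind hv hC (hwc n) (hwi n)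
      n).trans (mul_le_mul_of_nonneg_left ?_ (by positivity))
    have hsum : ∑ i ∈ Finset.range n, ∫ ω, |w n i ω| ^ 3 ∂μ ≤ ∑ i ∈ Finset.range n, |r n| ^ 3 * M := by
      refine Finset.sum_le_sum fun i _ => ?_
      refine (integral_mono (hwi n i) ((hint i).const_mul _) (hwy n i)).trans ?_
      rw [integral_const_mul]
      exact mul_le_mul_of_nonneg_left (hM i) (by positivity)
    refine hsum.trans_eq ?_
    rw [Finset.sum_const, Finset.card_range, nsmul_eq_mul, hr, abs_mul, abs_inv,
      abs_of_nonneg (Real.sqrt_nonneg _), mul_pow]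
    rcases Nat.eq_zero_or_pos n with rfl | hn
    · simp
    · have h : (n : ℝ) = √n * √n := (Real.mul_self_sqrt (Nat.cast_nonneg n)).symm
      have : √(n : ℝ) ≠ 0 := by positivity
      nth_rewrite 1 [h]
      field_simp
  -- replacing the truncated sums by the original ones is asymptotically negligible
  have h2 : TendstoInMeasure μ (fun n ω => Complex.exp (a : ℝ) * Y n ω - Z n ω) atTop
      fun _ => 0 := by
    refine tendstoInMeasure_of_dist_lt hqlim fun δ hδ => ?_
    have hcont : ContinuousAt (fun x : ℝ => Complex.exp ((v / 2 * (t ^ 2 * x) : ℝ))) q := by fun_prop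
    obtain ⟨η, hη, hη'⟩ := Metric.continuousAt_iff.1 hcont δ hδ
    -- The bound `η` serves the continuity of the exponential; the bound `1` keeps `∑ y² / n` below
    -- `q + 1`, so that no weight is truncated.
    refine ⟨min η 1, by positivity, ?_⟩
    filter_upwards [eventually_gt_atTop 0] with n hn ω hω
    have hn' : (0 : ℝ) < n := by exact_mod_cast hn
    have hV : ∑ i ∈ Finset.range n, y i ω ^ 2 ≤ n * (q + 1) := by
      have := (abs_lt.1 (hω.trans_le (min_le_right _ _))).2
      rw [sub_lt_iff_lt_add', div_lt_iff₀ hn'] at this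
      linarith
    have hwr : ∀ i ∈ Finset.range n, w n i ω = r n * y i ω := fun i hi => by
      simp only [hw]
      rw [if_pos]
      refine le_trans (Finset.sum_le_sum_of_subset_of_nonneg ?_ fun _ _ _ => sq_nonneg _) hV
      exact Finset.range_subset_range.2 (Finset.mem_range.1 hi)
    have hSS : S' n ω = t * ((√(n : ℝ))⁻¹ * ∑ i ∈ Finset.range n, y i ω * e i ω) := by
      simp only [hS']
      rw [Finset.sum_congr rfl fun i hi => by rw [hwr i hi], ← mul_assoc, Finset.mul_sum]
      exact Finset.sum_congr rfl fun i _ => by rw [mul_assoc]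
    have hVV : V' n ω = t ^ 2 * ((∑ i ∈ Finset.range n, y i ω ^ 2) / n) := by
      simp only [hV']
      rw [Finset.sum_congr rfl fun i hi => by rw [hwr i hi, mul_pow], ← Finset.mul_sum, hr]
      simp only [mul_pow, inv_pow, Real.sq_sqrt hn'.le]
      field_simp
    have key := hη' (hω.trans_le (min_le_left _ _))
    have hYZ : Complex.exp (a : ℝ) * Y n ω - Z n ω
        = Y n ω * (Complex.exp (a : ℝ) - Complex.exp ((v / 2 * V' n ω : ℝ))) := by
      simp only [hZ, hY, hSS]; ring
    rw [dist_zero_right, hYZ, norm_mul, Complex.norm_exp_ofReal_mul_I, one_mul, norm_sub_rev, hVV,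
      ← dist_eq_norm]
    have : a = v / 2 * (t ^ 2 * q) := by rw [ha]; ring
    rw [this]
    exact key
  have h3 := tendsto_integral_norm_of_tendstoInMeasure
    (fun n => ((hYm n).const_mul _ |>.sub (hZm n)).aestronglyMeasurable)
    (B := Real.exp a + Real.exp (v / 2 * c)) (fun n ω => by
      refine (norm_sub_le _ _).trans (add_le_add ?_ (hZB n ω))
      rw [norm_mul, Complex.norm_exp_ofReal_mul_I, mul_one, ← Complex.ofReal_exp,
        Complex.norm_real, Real.norm_eq_abs, Real.abs_exp]) h2
  have hYi : ∀ n, Integrable (Y n) μ := fun n => Integrable.of_bound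
    (hYm n).aestronglyMeasurable 1 (ae_of_all _ fun ω => (Complex.norm_exp_ofReal_mul_I _).le)
  have hZi : ∀ n, Integrable (Z n) μ := fun n => Integrable.of_bound
    (hZm n).aestronglyMeasurable _ (ae_of_all _ (hZB n))
  have h4 : Tendsto (fun n => Complex.exp (a : ℝ) * ∫ ω, Y n ω ∂μ) atTop (𝓝 1) := by
    have h5 : Tendsto (fun n => ∫ ω, (Complex.exp (a : ℝ) * Y n ω - Z n ω) ∂μ) atTop (𝓝 0) :=
      squeeze_zero_norm (fun n => norm_integral_le_integral_norm _) h3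
    have := h5.add h1
    rw [zero_add] at this
    refine this.congr fun n => ?_
    rw [integral_sub ((hYi n).const_mul _) (hZi n), integral_const_mul, sub_add_cancel]
  have h6 := h4.const_mul (Complex.exp ((-a : ℝ)))
  rw [mul_one] at h6
  refine h6.congr fun n => ?_
  rw [← mul_assoc, ← Complex.exp_add, ← Complex.ofReal_add, neg_add_cancel, Complex.ofReal_zero,
    Complex.exp_zero, one_mul]

/-- Central limit theorem for `∑ y_i e_i`, where `y_i` is known at time `i` and the innovation `e_i`
is independent of the information available at time `i`. -/
theorem tendstoInDistribution_sum_mul (F : ℕ → MeasurableSpace Ω) (hle : ∀ n, F n ≤ m0)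
    (hmono : Monotone F) {y e : ℕ → Ω → ℝ} (hy : ∀ i, Measurable[F i] (y i))
    (he : ∀ i, Measurable[F (i + 1)] (e i))
    (hind : ∀ i, Indep (F i) (MeasurableSpace.comap (e i) inferInstance) μ)
    (hid : ∀ i, IdentDistrib (e i) (e 0) μ μ) (h3 : MemLp (e 0) 3 μ) (h0 : ∫ ω, e 0 ω ∂μ = 0)
    {M q : ℝ} (hq : 0 ≤ q)
    (hint : ∀ i, Integrable (fun ω => |y i ω| ^ 3) μ) (hM : ∀ i, ∫ ω, |y i ω| ^ 3 ∂μ ≤ M)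
    (hqlim : TendstoInMeasure μ (fun n ω => (∑ i ∈ Finset.range n, y i ω ^ 2) / n) atTop
      fun _ => q) :
    TendstoInDistribution (fun (n : ℕ) ω => (√(n : ℝ))⁻¹ * ∑ i ∈ Finset.range n, y i ω * e i ω)
      atTop (id : ℝ → ℝ) (fun _ => μ) (gaussianReal 0 ((∫ ω, e 0 ω ^ 2 ∂μ) * q).toNNReal) := by
  have hmy : ∀ i, Measurable (y i) := fun i => (hy i).mono (hle _) le_rfl
  have hme : ∀ i, Measurable (e i) := fun i => (he i).mono (hle _) le_rfl
  have hprob : IsProbabilityMeasure (μ.map (e 0)) :=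
    Measure.isProbabilityMeasure_map (hme 0).aemeasurable
  have hv : ∫ x, x ^ 2 ∂(μ.map (e 0)) = ∫ ω, e 0 ω ^ 2 ∂μ :=
    integral_map (hme 0).aemeasurable (by fun_prop)
  obtain ⟨C, -, hC⟩ := exists_norm_charFun_sub_exp_le (ν := μ.map (e 0))
    ((memLp_map_measure_iff (by fun_prop) (hme 0).aemeasurable).2 h3)
    (by rw [integral_map (hme 0).aemeasurable (by fun_prop)]; exact h0)
  rw [hv] at hC
  have hv0 : 0 ≤ ∫ ω, e 0 ω ^ 2 ∂μ := integral_nonneg fun _ => sq_nonneg _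
  have hm : ∀ n : ℕ, Measurable fun ω => (√(n : ℝ))⁻¹ * ∑ i ∈ Finset.range n, y i ω * e i ω :=
    fun n => by fun_prop
  refine ⟨fun n => (hm n).aemeasurable, by fun_prop, ?_⟩
  refine ProbabilityMeasure.tendsto_iff_tendsto_charFun.2 fun t => ?_
  simp only [ProbabilityMeasure.coe_mk, Measure.map_id]
  have := tendsto_charFun_sum_mul F hle hmono hy he hind hv0 hq
    (fun i u => by rw [(hid i).map_eq]; exact hC u) hint hM hqlim t
  rw [charFun_gaussianReal]
  convert! this using 2 with n
  · rw [charFun_apply_real, integral_map (hm n).aemeasurable (by fun_prop)]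
    congr 1; ext ω; push_cast; rfl
  · rw [Real.coe_toNNReal _ (mul_nonneg hv0 hq)]
    push_cast
    congr 1
    simp

end MartingaleCLT

/-! ## Continuity of translation in `L¹` and decoupling by a density -/

/-- The `L¹`-distance between `f` and its translate by `δ`. -/
noncomputable def translateDist (f : ℝ → ℝ) (δ : ℝ) : ℝ := ∫ x, |f (x - δ) - f x|

theorem translateDist_nonneg (f : ℝ → ℝ) (δ : ℝ) : 0 ≤ translateDist f δ :=
  integral_nonneg fun _ => abs_nonneg _

theorem translateDist_le {f : ℝ → ℝ} (hf : Integrable f) (δ : ℝ) :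
    translateDist f δ ≤ 2 * ∫ x, |f x| := by
  have h1 : Integrable fun x => |f (x - δ)| := (hf.comp_sub_right δ).abs
  calc translateDist f δ ≤ ∫ x, (|f (x - δ)| + |f x|) :=
        integral_mono ((hf.comp_sub_right δ).sub hf).abs (h1.add hf.abs) fun x => abs_sub _ _
    _ = 2 * ∫ x, |f x| := by
        rw [integral_add h1 hf.abs, integral_sub_right_eq_self (fun x => |f x|) δ]; ring

theorem measurable_translateDist {f : ℝ → ℝ} (hf : Measurable f) :
    Measurable (translateDist f) := by
  have : StronglyMeasurable fun p : ℝ × ℝ => |f (p.2 - p.1) - f p.2| :=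
    Measurable.stronglyMeasurable (by fun_prop)
  exact this.integral_prod_right'.measurable

/-- This is the continuity of the translation action on `L¹`; integrability of the density suffices,
with no smoothness. -/
theorem tendsto_translateDist {f : ℝ → ℝ} (hf : Integrable f) :
    Tendsto (translateDist f) (𝓝 0) (𝓝 0) := by
  have hm : MemLp f 1 volume := memLp_one_iff_integrable.2 hf
  have : Fact ((1 : ℝ≥0∞) ≠ ∞) := ⟨by simp⟩
  have hc : Continuous fun δ : ℝ => DomAddAct.mk (-δ) +ᵥ hm.toLp f := by
    have : Continuous fun δ : ℝ => DomAddAct.mk (-δ) :=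
      DomAddAct.mkHomeomorph.continuous.comp continuous_neg
    exact this.vadd continuous_const
  have ht := ((hc.sub (continuous_const (y := hm.toLp f))).norm).tendsto 0
  have e : ∀ δ : ℝ, ‖(DomAddAct.mk (-δ) +ᵥ hm.toLp f) - hm.toLp f‖ = translateDist f δ := fun δ => by
    have h : DomAddAct.mk (-δ) +ᵥ hm.toLp f = _ := DomAddAct.mk_vadd_toLp (-δ) hm
    rw [h, ← MemLp.toLp_sub, Lp.norm_toLp, eLpNorm_one_eq_lintegral_enorm,
      ← integral_norm_eq_lintegral_enorm]
    · refine integral_congr_ae (ae_of_all _ fun x => ?_)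
      simp [sub_eq_add_neg, add_comm]
    · exact ((hf.comp_add_left (-δ)).sub hf).aestronglyMeasurable
  have ht' := ht.congr e
  convert! ht' using 2
  simp

section Decoupling

variable {Ω : Type*} [MeasurableSpace Ω] {μ : Measure Ω} [IsProbabilityMeasure μ]
  {E G : Type*} [MeasurableSpace E] [MeasurableSpace G]

theorem abs_integral_le_of_abs_le {h : Ω → ℝ} {C : ℝ} (hC : ∀ ω, |h ω| ≤ C) :
    |∫ ω, h ω ∂μ| ≤ C := by
  simpa using norm_integral_le_of_norm_le_const (μ := μ) (f := h) (ae_of_all _ hC)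

theorem integrable_density {ξ : Ω → ℝ} {f : ℝ → ℝ} (hξ : Measurable ξ) (hf : Measurable f)
    (hf0 : ∀ x, 0 ≤ f x)
    (hlaw : μ.map ξ = volume.withDensity fun x => ENNReal.ofReal (f x)) : Integrable f := by
  have : IsProbabilityMeasure (μ.map ξ) := Measure.isProbabilityMeasure_map hξ.aemeasurable
  have h1 : ∫⁻ x, ENNReal.ofReal (f x) = 1 := by
    have := measure_univ (μ := μ.map ξ)
    rwa [hlaw, withDensity_apply _ MeasurableSet.univ, Measure.restrict_univ] at this
  exact (lintegral_ofReal_ne_top_iff_integrable hf.aestronglyMeasurable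
    (ae_of_all _ hf0)).1 (by simp [h1])

/-- With `R` frozen, a change of variables moves the shift from the test function, which is merely
measurable, to the density. -/
theorem abs_integral_shift_sub_le {ξ : Ω → ℝ} {R : Ω → G} (hξ : Measurable ξ) (hR : Measurable R)
    (hξR : IndepFun ξ R μ) {f : ℝ → ℝ} (hf : Measurable f) (hf0 : ∀ x, 0 ≤ f x)
    (hlaw : μ.map ξ = volume.withDensity fun x => ENNReal.ofReal (f x))
    {ψ : ℝ × G → ℝ} (hψ : Measurable ψ) (hψ1 : ∀ p, |ψ p| ≤ 1) (α : ℝ) :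
    |∫ ω, ψ (α + ξ ω, R ω) ∂μ - ∫ ω, ψ (ξ ω, R ω) ∂μ| ≤ translateDist f α := by
  have hfi := integrable_density hξ hf hf0 hlaw
  have hprob : IsProbabilityMeasure (μ.map ξ) := Measure.isProbabilityMeasure_map hξ.aemeasurable
  have key : ∀ (α : ℝ) (r : G), ∫ x, ψ (α + x, r) ∂(μ.map ξ) = ∫ x, ψ (x, r) * f (x - α) :=
      fun α r => by
    rw [hlaw, integral_withDensity_eq_integral_toReal_smul (by fun_prop) (by simp),
      ← integral_sub_right_eq_self _ α]
    refine integral_congr_ae (ae_of_all _ fun x => ?_)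
    simp only [smul_eq_mul, ENNReal.toReal_ofReal (hf0 _)]
    rw [add_sub_cancel, mul_comm]
  have hb : ∀ (α : ℝ), Integrable (fun ω => ψ (α + ξ ω, R ω)) μ := fun α =>
    Integrable.of_bound (Measurable.aestronglyMeasurable (by fun_prop)) 1 (ae_of_all _ fun _ => hψ1 _)
  have hM : ∀ α : ℝ, ∫ ω, ψ (α + ξ ω, R ω) ∂μ = ∫ ω, (∫ x, ψ (x, R ω) * f (x - α)) ∂μ := fun α => by
    have := integral_prodMk_of_indepFun hR hξ hξR.symm
      (k := fun p : G × ℝ => ψ (α + p.2, p.1)) (Measurable.stronglyMeasurable (by fun_prop)) (hb α)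
    simp only at this
    rw [this]
    simp only [key]
  have hint : ∀ (α : ℝ) (r : G), Integrable fun x => ψ (x, r) * f (x - α) := fun α r =>
    (hfi.comp_sub_right α).bdd_mul (c := 1) (Measurable.aestronglyMeasurable (by fun_prop))
      (ae_of_all _ fun _ => hψ1 _)
  have hint2 : ∀ α : ℝ, Integrable (fun ω => ∫ x, ψ (x, R ω) * f (x - α)) μ := fun α => by
    simp only [← key]
    refine Integrable.of_bound ?_ 1 (ae_of_all _ fun ω => ?_)
    · have : StronglyMeasurable fun p : Ω × ℝ => ψ (α + p.2, R p.1) :=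
        Measurable.stronglyMeasurable (by fun_prop)
      exact this.integral_prod_right'.aestronglyMeasurable
    · refine (norm_integral_le_of_norm_le_const (C := 1) (ae_of_all _ fun _ => hψ1 _)).trans ?_
      simp
  have h0 := hM 0
  simp only [zero_add] at h0
  rw [hM α, h0, ← integral_sub (hint2 α) (hint2 0)]
  refine abs_integral_le_of_abs_le fun ω => ?_
  rw [← integral_sub (hint _ _) (hint _ _), ← Real.norm_eq_abs]
  refine norm_integral_le_of_norm_le ((hfi.comp_sub_right α).sub hfi).abs
    (ae_of_all _ fun x => ?_)
  rw [sub_zero, ← mul_sub, norm_mul]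
  exact mul_le_of_le_one_left (norm_nonneg _) (hψ1 _)

/-- If `ξ` has density `f` and is independent of `(U, R)`, and `R` is independent of `U`, then a
bounded function of `U` is nearly uncorrelated with functions of `(a(U) + ξ, R)` when the shift
`a(U)` is small. -/
theorem abs_covariance_shift_le {U : Ω → E} {ξ : Ω → ℝ} {R : Ω → G} (hU : Measurable U)
    (hξ : Measurable ξ) (hR : Measurable R) (hUξR : IndepFun U (fun ω => (ξ ω, R ω)) μ)
    (hξR : IndepFun ξ R μ) {f : ℝ → ℝ} (hf : Measurable f) (hf0 : ∀ x, 0 ≤ f x)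
    (hlaw : μ.map ξ = volume.withDensity fun x => ENNReal.ofReal (f x))
    {ψ : ℝ × G → ℝ} (hψ : Measurable ψ) (hψ1 : ∀ p, |ψ p| ≤ 1) {a g : E → ℝ} (ha : Measurable a)
    (hg : Measurable g) {B : ℝ} (hgB : ∀ x, |g x| ≤ B) :
    |∫ ω, g (U ω) * ψ (a (U ω) + ξ ω, R ω) ∂μ
        - (∫ ω, g (U ω) ∂μ) * ∫ ω, ψ (a (U ω) + ξ ω, R ω) ∂μ|
      ≤ 2 * B * ∫ ω, translateDist f (a (U ω)) ∂μ := by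
  have hfi := integrable_density hξ hf hf0 hlaw
  set M : ℝ → ℝ := fun α => ∫ ω, ψ (α + ξ ω, R ω) ∂μ with hMdef
  have hξRm : Measurable fun ω => (ξ ω, R ω) := hξ.prodMk hR
  have hMm : Measurable M := by
    have : StronglyMeasurable fun p : ℝ × Ω => ψ (p.1 + ξ p.2, R p.2) :=
      Measurable.stronglyMeasurable (by fun_prop)
    exact this.integral_prod_right'.measurable
  have hM1 : ∀ α, |M α| ≤ 1 := fun α => abs_integral_le_of_abs_le fun _ => hψ1 _
  have step : ∀ g : E → ℝ, Measurable g → (∃ B, ∀ x, |g x| ≤ B) →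
      ∫ ω, g (U ω) * ψ (a (U ω) + ξ ω, R ω) ∂μ = ∫ ω, g (U ω) * M (a (U ω)) ∂μ := by
    rintro g hg ⟨B, hB⟩
    have := integral_prodMk_of_indepFun hU hξRm hUξR
      (k := fun p : E × (ℝ × G) => g p.1 * ψ (a p.1 + p.2.1, p.2.2))
      (Measurable.stronglyMeasurable (by fun_prop)) ?_
    · simp only at this
      rw [this]
      refine integral_congr_ae (ae_of_all _ fun ω => ?_)
      simp only
      rw [integral_const_mul, hMdef, integral_map hξRm.aemeasurable
        (Measurable.aestronglyMeasurable (by fun_prop))]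
    · refine Integrable.of_bound (Measurable.aestronglyMeasurable (by fun_prop)) (B * 1)
        (ae_of_all _ fun ω => ?_)
      rw [norm_mul]
      exact mul_le_mul (hB _) (hψ1 _) (norm_nonneg _) ((abs_nonneg _).trans (hB (U ω)))
  have s1 := step g hg ⟨B, hgB⟩
  have s2 := step (fun _ => 1) measurable_const ⟨1, by simp⟩
  simp only [one_mul] at s2
  -- Given `U`, the mean of `ψ` is `M (a U)`. The constant `M 0` contributes nothing to the
  -- covariance, and the remainder `D` is bounded by the translation distance. It occurs in both
  -- terms of the covariance, hence the factor `2`.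
  set D : Ω → ℝ := fun ω => M (a (U ω)) - M 0 with hD
  have hDm : Measurable D := by fun_prop
  have hDle : ∀ ω, |D ω| ≤ translateDist f (a (U ω)) := fun ω => by
    have := abs_integral_shift_sub_le hξ hR hξR hf hf0 hlaw hψ hψ1 (a (U ω))
    simpa [hD, hMdef] using this
  have hDi : Integrable D μ := Integrable.of_bound hDm.aestronglyMeasurable (1 + 1)
    (ae_of_all _ fun ω => (abs_sub _ _).trans (add_le_add (hM1 _) (hM1 _)))
  have hgi : Integrable (fun ω => g (U ω)) μ :=
    Integrable.of_bound (hg.comp hU).aestronglyMeasurable B (ae_of_all _ fun _ => hgB _)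
  have hgDi : Integrable (fun ω => g (U ω) * D ω) μ :=
    hDi.bdd_mul (hg.comp hU).aestronglyMeasurable (ae_of_all _ fun _ => hgB _)
  have hρi : Integrable (fun ω => translateDist f (a (U ω))) μ :=
    Integrable.of_bound (((measurable_translateDist hf).comp (ha.comp hU)).aestronglyMeasurable)
      (2 * ∫ x, |f x|) (ae_of_all _ fun ω => by
        rw [Real.norm_of_nonneg (translateDist_nonneg _ _)]; exact translateDist_le hfi _)
  have e1 : ∫ ω, g (U ω) * M (a (U ω)) ∂μ = ∫ ω, g (U ω) * D ω ∂μ + (∫ ω, g (U ω) ∂μ) * M 0 := by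
    rw [← integral_mul_const, ← integral_add hgDi (hgi.mul_const _)]
    refine integral_congr_ae (ae_of_all _ fun ω => ?_)
    simp only [hD]; ring
  have e2 : ∫ ω, M (a (U ω)) ∂μ = ∫ ω, D ω ∂μ + M 0 := by
    have : ∫ ω, M (a (U ω)) ∂μ = ∫ ω, (D ω + M 0) ∂μ := by simp [hD]
    rw [this, integral_add hDi (integrable_const _)]; simp
  have hB0 : 0 ≤ B := by
    obtain ⟨ω⟩ : Nonempty Ω := μ.nonempty_of_neZero
    exact (abs_nonneg _).trans (hgB (U ω))
  have b1 : |∫ ω, g (U ω) * D ω ∂μ| ≤ B * ∫ ω, translateDist f (a (U ω)) ∂μ := by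
    rw [← integral_const_mul, ← Real.norm_eq_abs]
    refine norm_integral_le_of_norm_le (hρi.const_mul B) (ae_of_all _ fun ω => ?_)
    rw [norm_mul]
    exact mul_le_mul (hgB _) (hDle ω) (norm_nonneg _) hB0
  have b2 : |∫ ω, D ω ∂μ| ≤ ∫ ω, translateDist f (a (U ω)) ∂μ := by
    rw [← Real.norm_eq_abs]
    exact norm_integral_le_of_norm_le hρi (ae_of_all _ hDle)
  have b3 : |∫ ω, g (U ω) ∂μ| ≤ B := abs_integral_le_of_abs_le fun _ => hgB _
  rw [s1, s2, e1, e2]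
  have : ∫ ω, g (U ω) * D ω ∂μ + (∫ ω, g (U ω) ∂μ) * M 0
      - (∫ ω, g (U ω) ∂μ) * (∫ ω, D ω ∂μ + M 0)
      = ∫ ω, g (U ω) * D ω ∂μ - (∫ ω, g (U ω) ∂μ) * ∫ ω, D ω ∂μ := by ring
  rw [this]
  refine (abs_sub _ _).trans ?_
  rw [abs_mul]
  have := mul_le_mul b3 b2 (abs_nonneg _) hB0
  linarith

end Decoupling

/-! ## Basic properties of the causal AR(1) model -/

/-- The information in the innovations with index in `S`. -/
abbrev innovSigma {Ω : Type u} (ε : ℤ → Ω → ℝ) (S : Set ℤ) : MeasurableSpace Ω :=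
  ⨆ s ∈ S, MeasurableSpace.comap (ε s) inferInstance

/-- The information in the process and the innovations up to time `n`. -/
abbrev pastSigma {Ω : Type u} (ε X : ℤ → Ω → ℝ) (n : ℤ) : MeasurableSpace Ω :=
  MeasurableSpace.comap (fun ω (s : Set.Iic n) => (X s ω, ε s ω)) inferInstance

section

theorem measurable_of_forall_apply {Ω ι : Type*} {β : ι → Type*} {m : MeasurableSpace Ω}
    [∀ i, MeasurableSpace (β i)] {f : Ω → ∀ i, β i} (hf : ∀ i, Measurable fun ω => f ω i) :
    Measurable f :=
  measurable_pi_iff.2 hf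

variable {Ω : Type u} {ε X : ℤ → Ω → ℝ}

theorem measurable_innovSigma {S : Set ℤ} {s : ℤ} (hs : s ∈ S) :
    Measurable[innovSigma ε S] (ε s) :=
  (comap_measurable (ε s)).mono (le_iSup₂_of_le s hs le_rfl) le_rfl

theorem innovSigma_mono {S T : Set ℤ} (h : S ⊆ T) : innovSigma ε S ≤ innovSigma ε T :=
  biSup_mono h

theorem measurable_pastSigma {n s : ℤ} (hs : s ≤ n) :
    Measurable[pastSigma ε X n] fun ω => (X s ω, ε s ω) :=
  (measurable_pi_apply (⟨s, hs⟩ : Set.Iic n)).comp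
    (comap_measurable fun ω (s : Set.Iic n) => (X s ω, ε s ω))

theorem measurable_pastSigma_process {n s : ℤ} (hs : s ≤ n) :
    Measurable[pastSigma ε X n] (X s) :=
  measurable_fst.comp (measurable_pastSigma hs)

theorem measurable_pastSigma_innov {n s : ℤ} (hs : s ≤ n) :
    Measurable[pastSigma ε X n] (ε s) :=
  measurable_snd.comp (measurable_pastSigma hs)

theorem pastSigma_mono {n k : ℤ} (h : n ≤ k) : pastSigma ε X n ≤ pastSigma ε X k := by
  have : Measurable[pastSigma ε X k] fun ω (s : Set.Iic n) => (X s ω, ε s ω) :=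
    measurable_of_forall_apply fun s => measurable_pastSigma (s.2.trans h)
  exact this.comap_le

variable [MeasurableSpace Ω] {μ : Measure Ω} [IsProbabilityMeasure μ] {Θ : Set ℝ} {β₀ : ℝ}

namespace AR1Model

theorem innovSigma_le (hX : AR1Model μ Θ β₀ ε X) (S : Set ℤ) : innovSigma ε S ≤ ‹_› :=
  iSup₂_le fun s _ => (hX.innov_measurable s).comap_le

theorem measurable_pair (hX : AR1Model μ Θ β₀ ε X) (n : ℤ) :
    Measurable fun ω (s : Set.Iic n) => (X s ω, ε s ω) :=
  measurable_pi_iff.2 fun s => (hX.measurable s).prodMk (hX.innov_measurable s)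

theorem pastSigma_le (hX : AR1Model μ Θ β₀ ε X) (n : ℤ) : pastSigma ε X n ≤ ‹_› :=
  (hX.measurable_pair n).comap_le

theorem indep_innovSigma (hX : AR1Model μ Θ β₀ ε X) {S T : Set ℤ} (h : Disjoint S T) :
    Indep (innovSigma ε S) (innovSigma ε T) μ :=
  indep_iSup_of_disjoint (fun i => (hX.innov_measurable i).comap_le) hX.innov_indep.iIndep h

/-- The process is a fixed measurable function of the present and past innovations. -/
theorem exists_eq_function_innov (hX : AR1Model μ Θ β₀ ε X) :
    ∃ G : (ℕ → ℝ) → ℝ, Measurable G ∧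
      ∀ t : ℤ, ∀ᵐ ω ∂μ, X t ω = G (fun j => ε (t - j) ω) := by
  obtain ⟨ϑ, -, hϑ⟩ := hX.causal
  refine ⟨fun z => limUnder atTop fun n => ∑ j ∈ Finset.range n, ϑ j * z j, ?_, fun t => ?_⟩
  · refine (StronglyMeasurable.limUnder fun n => ?_).measurable
    exact Measurable.stronglyMeasurable (by fun_prop)
  · filter_upwards [hϑ t] with ω hω
    exact hω.tendsto_sum_nat.limUnder_eq.symm

theorem ae_recursion (hX : AR1Model μ Θ β₀ ε X) :
    ∀ᵐ ω ∂μ, ∀ t : ℤ, X t ω = β₀ * X (t - 1) ω + ε t ω :=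
  ae_all_iff.2 hX.recursion

theorem ae_iterate (hX : AR1Model μ Θ β₀ ε X) :
    ∀ᵐ ω ∂μ, ∀ (k : ℕ) (t : ℤ),
      X t ω = β₀ ^ k * X (t - k) ω + ∑ i ∈ Finset.range k, β₀ ^ i * ε (t - i) ω := by
  filter_upwards [hX.ae_recursion] with ω hω k t
  induction k with
  | zero => simp
  | succ k ih =>
    rw [ih, hω (t - k), Finset.sum_range_succ, pow_succ,
      show t - ((k + 1 : ℕ) : ℤ) = t - k - 1 by push_cast; ring]
    ring

/-- Each shifted process is the image of the shifted innovations under one and the same map `Φ`, and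
all shifts of an i.i.d. family have the same product law. -/
theorem strictlyStationary (hX : AR1Model μ Θ β₀ ε X) : StrictlyStationary μ X := by
  intro k
  obtain ⟨G, hG, hXG⟩ := hX.exists_eq_function_innov
  set Φ : (ℤ → ℝ) → ℤ → ℝ := fun e t => G fun j : ℕ => e (t - j) with hΦ
  have hΦm : Measurable Φ := measurable_pi_iff.2 fun t =>
    hG.comp (measurable_pi_iff.2 fun j => measurable_pi_apply _)
  have hm : ∀ k : ℤ, Measurable fun ω (t : ℤ) => ε (t + k) ω := fun k =>
    measurable_pi_iff.2 fun t => hX.innov_measurable _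
  have hlaw : ∀ k : ℤ, μ.map (fun ω (t : ℤ) => ε (t + k) ω)
      = Measure.infinitePi fun _ : ℤ => μ.map (ε 0) := fun k => by
    have hi : iIndepFun (fun t : ℤ => ε (t + k)) μ :=
      hX.innov_indep.precomp (add_left_injective k)
    rw [hi.map_fun_eq_infinitePi_map fun t => hX.innov_measurable _]
    congr 1; ext1 t
    exact (hX.innov_identDistrib _).map_eq
  have hae : ∀ k : ℤ, (fun ω (t : ℤ) => X (t + k) ω) =ᵐ[μ] fun ω => Φ fun t => ε (t + k) ω :=
      fun k => by
    filter_upwards [ae_all_iff.2 hXG] with ω hω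
    ext t
    rw [hω (t + k), hΦ]
    simp only
    congr 1; ext j
    rw [sub_add_eq_add_sub]
  have hXm : ∀ k : ℤ, AEMeasurable (fun ω (t : ℤ) => X (t + k) ω) μ := fun k =>
    (measurable_pi_iff.2 fun t => hX.measurable _).aemeasurable
  have hlaw2 : ∀ k : ℤ, μ.map (fun ω (t : ℤ) => X (t + k) ω)
      = (Measure.infinitePi fun _ : ℤ => μ.map (ε 0)).map Φ := fun k => by
    rw [Measure.map_congr (hae k), ← hlaw k, Measure.map_map hΦm (hm k)]
    rfl
  have h0 := hlaw2 0
  have h1 := hXm 0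
  simp only [add_zero] at h0 h1
  exact ⟨hXm k, h1, (hlaw2 k).trans h0.symm⟩

theorem identDistrib (hX : AR1Model μ Θ β₀ ε X) (t : ℤ) : IdentDistrib (X t) (X 0) μ μ := by
  have := (hX.strictlyStationary t).comp (measurable_pi_apply (0 : ℤ))
  simpa [Function.comp_def] using this

/-- The past of the process is independent of the future innovations. -/
theorem indepFun_past_future (hX : AR1Model μ Θ β₀ ε X) (n : ℤ) {F : Type*} [MeasurableSpace F]
    {g : Ω → F} (hg : Measurable[innovSigma ε (Set.Ioi n)] g) :
    IndepFun (fun ω (s : Set.Iic n) => (X s ω, ε s ω)) g μ := by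
  obtain ⟨G, hG, hXG⟩ := hX.exists_eq_function_innov
  -- `X` is only almost surely a function of the innovations, so it need not be measurable for their
  -- σ-algebra. Independence is shown for the version built from `G` and then carried over.
  have h1 : IndepFun (fun ω (s : Set.Iic n) => (G (fun j => ε (s - j) ω), ε s ω)) g μ := by
    refine indep_of_indep_of_le (hX.indep_innovSigma (S := Set.Iic n) (T := Set.Ioi n) ?_) ?_
      hg.comap_le
    · exact Set.disjoint_left.2 fun x hx hx' => absurd (Set.mem_Ioi.1 hx') (not_lt.2 hx)
    · refine Measurable.comap_le (measurable_of_forall_apply fun s => ?_)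
      refine (hG.comp (measurable_of_forall_apply fun j => ?_)).prodMk (measurable_innovSigma s.2)
      exact measurable_innovSigma (by have := s.2; simp only [Set.mem_Iic] at *; omega)
  refine h1.congr ?_ (ae_eq_refl _)
  filter_upwards [ae_all_iff.2 hXG] with ω hω
  ext1 s
  rw [hω s]

theorem indep_past_future (hX : AR1Model μ Θ β₀ ε X) (n : ℤ) :
    Indep (pastSigma ε X n) (innovSigma ε (Set.Ioi n)) μ := by
  -- Taking for `g` the identity into `Ω` equipped with the future σ-algebra turns independence of
  -- functions into independence of σ-algebras.
  have := @indepFun_past_future Ω ε X _ μ _ Θ β₀ hX n Ω (innovSigma ε (Set.Ioi n)) id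
    (@measurable_id _ (innovSigma ε (Set.Ioi n)))
  have h : Indep (pastSigma ε X n) (MeasurableSpace.comap id (innovSigma ε (Set.Ioi n))) μ := this
  rwa [MeasurableSpace.comap_id] at h

theorem indep_past_innov (hX : AR1Model μ Θ β₀ ε X) {n t : ℤ} (h : n < t) :
    Indep (pastSigma ε X n) (MeasurableSpace.comap (ε t) inferInstance) μ :=
  indep_of_indep_of_le_right (hX.indep_past_future n)
    (measurable_innovSigma (S := Set.Ioi n) h).comap_le

theorem indepFun_of_measurable_past (hX : AR1Model μ Θ β₀ ε X) {n t : ℤ} (h : n < t) {F : Type*}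
    [MeasurableSpace F] {f : Ω → F} (hf : Measurable[pastSigma ε X n] f) :
    IndepFun f (ε t) μ :=
  indep_of_indep_of_le_left (hX.indep_past_innov h) hf.comap_le

theorem memLp_innov (hX : AR1Model μ Θ β₀ ε X) (t : ℤ) : MemLp (ε t) 4 μ := by
  rw [(hX.innov_identDistrib t).memLp_iff]
  refine (integrable_norm_rpow_iff (hX.innov_measurable 0).aestronglyMeasurable (by norm_num)
    (by norm_num)).1 (hX.innov_fourth_moment.norm.congr (ae_of_all _ fun ω => ?_))
  have : (4 : ℝ≥0∞).toReal = ((4 : ℕ) : ℝ) := by norm_num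
  simp only [this, Real.rpow_natCast, norm_pow]

/-- By Minkowski the partial sums of the moving average have `L⁴` norm at most `∑ |ϑ_j|` times that
of `ε_0`; Fatou passes to the limit. -/
theorem memLp (hX : AR1Model μ Θ β₀ ε X) (t : ℤ) : MemLp (X t) 4 μ := by
  obtain ⟨ϑ, hsum, hϑ⟩ := hX.causal
  set g : ℕ → Ω → ℝ := fun n => ∑ j ∈ Finset.range n, fun ω => ϑ j * ε (t - j) ω with hg
  have hterm : ∀ j : ℕ, AEStronglyMeasurable (fun ω => ϑ j * ε (t - j) ω) μ := fun j =>
    ((hX.innov_measurable _).const_mul _).aestronglyMeasurable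
  have hgm : ∀ n, AEStronglyMeasurable (g n) μ := fun n =>
    Finset.aestronglyMeasurable_sum _ fun j _ => hterm j
  have hlim := Lp.eLpNorm_lim_le_liminf_eLpNorm (p := 4) hgm (X t) (by
    filter_upwards [hϑ t] with ω hω
    simpa [hg] using hω.tendsto_sum_nat)
  set A := eLpNorm (ε 0) 4 μ with hA
  have hA' : A ≠ ∞ := (hX.memLp_innov 0).2.ne
  have hb : ∀ n, eLpNorm (g n) 4 μ ≤ ENNReal.ofReal (∑' j, |ϑ j|) * A := fun n => by
    refine (eLpNorm_sum_le (fun j _ => hterm j) (by norm_num)).trans ?_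
    have : ∀ j ∈ Finset.range n, eLpNorm (fun ω => ϑ j * ε (t - j) ω) 4 μ
        = ENNReal.ofReal |ϑ j| * A := fun j _ => by
      have := eLpNorm_const_smul (ϑ j) (ε (t - j)) 4 μ
      rw [(hX.innov_identDistrib (t - j)).eLpNorm_eq, Real.enorm_eq_ofReal_abs] at this
      exact this
    rw [Finset.sum_congr rfl this, ← Finset.sum_mul,
      ← ENNReal.ofReal_sum_of_nonneg fun _ _ => abs_nonneg _]
    gcongr
    exact hsum.sum_le_tsum _ fun _ _ => abs_nonneg _
  have hle : eLpNorm (X t) 4 μ ≤ ENNReal.ofReal (∑' j, |ϑ j|) * A := hlim.trans <| liminf_le_of_le (by isBoundedDefault) fun b hb' => by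
    obtain ⟨n, hn⟩ := hb'.exists
    exact hn.trans (hb n)
  exact ⟨(hX.measurable t).aestronglyMeasurable,
    hle.trans_lt (ENNReal.mul_lt_top ENNReal.ofReal_lt_top hA'.lt_top)⟩

theorem abs_coeff_lt_one (hX : AR1Model μ Θ β₀ ε X) : |β₀| < 1 :=
  hX.abs_lt_one _ (interior_subset hX.mem_interior)

theorem coeff_sq_lt_one (hX : AR1Model μ Θ β₀ ε X) : β₀ ^ 2 < 1 :=
  (sq_lt_one_iff_abs_lt_one β₀).2 hX.abs_coeff_lt_one

theorem innov_measure_singleton (hX : AR1Model μ Θ β₀ ε X) (x : ℝ) : μ.map (ε 0) {x} = 0 := by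
  obtain ⟨f, -, -, hlaw⟩ := hX.innov_density
  rw [hlaw]
  exact withDensity_absolutelyContinuous _ _ (by simp)

/-- Given `X_{t-1}`, the event forces the independent innovation `ε_t` to take a single value, which
its density excludes. -/
theorem measure_eq_zero (hX : AR1Model μ Θ β₀ ε X) (t : ℤ) (x : ℝ) :
    μ {ω | X t ω = x} = 0 := by
  have hI : IndepFun (X (t - 1)) (ε t) μ :=
    hX.indepFun_of_measurable_past (sub_one_lt t) (measurable_pastSigma_process le_rfl)
  have hmap := (indepFun_iff_map_prod_eq_prod_map_map (hX.measurable _).aemeasurable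
    (hX.innov_measurable t).aemeasurable).1 hI
  have hs : MeasurableSet {p : ℝ × ℝ | β₀ * p.1 + p.2 = x} :=
    measurableSet_eq_fun (by fun_prop) (by fun_prop)
  have h1 : μ {ω | X t ω = x} = μ.map (fun ω => (X (t - 1) ω, ε t ω)) {p | β₀ * p.1 + p.2 = x} := by
    rw [Measure.map_apply ((hX.measurable _).prodMk (hX.innov_measurable t)) hs]
    refine measure_congr ?_
    filter_upwards [hX.recursion t] with ω hω
    exact propext (by change X t ω = x ↔ β₀ * X (t - 1) ω + ε t ω = x; rw [hω])
  rw [h1, hmap, Measure.prod_apply hs]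
  have : ∀ y, μ.map (ε t) (Prod.mk y ⁻¹' {p : ℝ × ℝ | β₀ * p.1 + p.2 = x}) = 0 := fun y => by
    have : Prod.mk y ⁻¹' {p : ℝ × ℝ | β₀ * p.1 + p.2 = x} = {x - β₀ * y} := by
      ext z
      simp only [Set.mem_preimage, Set.mem_ofPred_eq, Set.mem_singleton_iff]
      constructor <;> intro h <;> linarith
    rw [this, (hX.innov_identDistrib t).map_eq, hX.innov_measure_singleton]
  simp only [this, lintegral_zero]

theorem variance_innov_pos (hX : AR1Model μ Θ β₀ ε X) : 0 < ∫ ω, ε 0 ω ^ 2 ∂μ := by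
  have hi : Integrable (fun ω => ε 0 ω ^ 2) μ :=
    ((hX.memLp_innov 0).mono_exponent (p := 2) (by norm_num)).integrable_sq
  refine (integral_nonneg fun _ => sq_nonneg _).lt_of_ne' fun h => ?_
  have h0 := (integral_eq_zero_iff_of_nonneg (fun _ => sq_nonneg _) hi).1 h
  have h1 : μ {ω | ε 0 ω = 0} = 0 := by
    have := hX.innov_measure_singleton 0
    rwa [Measure.map_apply (hX.innov_measurable 0) (measurableSet_singleton _)] at this
  have h2 : ∀ᵐ ω ∂μ, ε 0 ω = 0 := by
    filter_upwards [h0] with ω hω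
    simpa using hω
  have h3 : μ Set.univ = 0 := by
    rw [← h1]
    refine measure_congr ?_
    filter_upwards [h2] with ω hω
    exact propext ⟨fun _ => hω, fun _ => trivial⟩
  simp at h3

end AR1Model
end

/-! ## Laws of large numbers by second moments -/

section SecondMoment

variable {Ω : Type*} {m0 : MeasurableSpace Ω} {μ : Measure Ω} [IsProbabilityMeasure μ]

theorem tendstoInMeasure_zero_add {f g : ℕ → Ω → ℝ}
    (hf : TendstoInMeasure μ f atTop fun _ => 0) (hg : TendstoInMeasure μ g atTop fun _ => 0) :
    TendstoInMeasure μ (fun n ω => f n ω + g n ω) atTop fun _ => 0 := by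
  rw [tendstoInMeasure_iff_norm] at hf hg ⊢
  intro δ hδ
  have h := (hf (δ / 2) (half_pos hδ)).add (hg (δ / 2) (half_pos hδ))
  rw [add_zero] at h
  refine tendsto_of_tendsto_of_tendsto_of_le_of_le tendsto_const_nhds h (fun _ => zero_le)
    fun n => (measure_mono fun ω hω => ?_).trans (measure_union_le _ _)
  simp only [Set.mem_ofPred_eq, sub_zero, Set.mem_union] at hω ⊢
  by_contra! hc
  have := norm_add_le (f n ω) (g n ω)
  linarith

theorem tendstoInMeasure_zero_const_mul {f : ℕ → Ω → ℝ}
    (hf : TendstoInMeasure μ f atTop fun _ => 0) (c : ℝ) :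
    TendstoInMeasure μ (fun n ω => c * f n ω) atTop fun _ => 0 := by
  have := tendstoInMeasure_comp_continuousAt hf (g := fun x : ℝ => c * x) (by fun_prop)
  simpa using this

theorem tendstoInMeasure_zero_of_integral_sq {f : ℕ → Ω → ℝ} (hf : ∀ n, MemLp (f n) 2 μ)
    (h : Tendsto (fun n => ∫ ω, f n ω ^ 2 ∂μ) atTop (𝓝 0)) :
    TendstoInMeasure μ f atTop fun _ => 0 := by
  have h2 : TendstoInMeasure μ (fun n ω => f n ω ^ 2) atTop fun _ => 0 :=
    tendstoInMeasure_of_integral_norm (fun n => (hf n).integrable_sq) (by simpa using h)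
  refine tendstoInMeasure_of_dist_lt h2 fun δ hδ => ⟨δ ^ 2, by positivity, ?_⟩
  refine Eventually.of_forall fun n ω hω => ?_
  rw [Real.dist_eq, sub_zero] at hω ⊢
  rw [abs_pow] at hω
  exact lt_of_pow_lt_pow_left₀ 2 hδ.le hω

/-- A sequence bounded in `L²` times a sequence converging to zero in probability. -/
theorem tendstoInMeasure_zero_mul_of_integral_sq_le {f g : ℕ → Ω → ℝ} {M : ℝ}
    (hf : ∀ n, MemLp (f n) 2 μ) (hM : ∀ n, ∫ ω, f n ω ^ 2 ∂μ ≤ M)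
    (hg : TendstoInMeasure μ g atTop fun _ => 0) :
    TendstoInMeasure μ (fun n ω => f n ω * g n ω) atTop fun _ => 0 := by
  rw [tendstoInMeasure_iff_measureReal_norm] at hg ⊢
  intro δ hδ
  rw [Metric.tendsto_atTop]
  intro η hη
  have hM0 : 0 ≤ M := (integral_nonneg fun _ => sq_nonneg _).trans (hM 0)
  -- Markov's inequality then bounds the probability of `f² ≥ K` by `M / K < η / 2`; the `+ 1` keeps
  -- `K` positive when `M = 0`.
  set K : ℝ := 2 * (M + 1) / η with hK
  have hK0 : 0 < K := by positivity
  obtain ⟨N, hN⟩ := Metric.tendsto_atTop.1 (hg (δ / √K) (by positivity)) (η / 2) (half_pos hη)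
  refine ⟨N, fun n hn => ?_⟩
  have h1 := hN n hn
  rw [Real.dist_eq, sub_zero, abs_of_nonneg measureReal_nonneg] at h1 ⊢
  have h2 : μ.real {ω | K ≤ f n ω ^ 2} ≤ M / K := by
    rw [le_div_iff₀ hK0, mul_comm]
    exact (mul_meas_ge_le_integral_of_nonneg (ae_of_all _ fun _ => sq_nonneg _)
      (hf n).integrable_sq K).trans (hM n)
  have h3 : M / K < η / 2 := by
    rw [hK, div_div_eq_mul_div, div_lt_div_iff₀ (by positivity) (by positivity)]
    nlinarith
  have h4 : {ω | δ ≤ ‖f n ω * g n ω - 0‖} ⊆ {ω | K ≤ f n ω ^ 2} ∪ {ω | δ / √K ≤ ‖g n ω - 0‖} := by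
    intro ω hω
    simp only [Set.mem_ofPred_eq, sub_zero, Set.mem_union, Real.norm_eq_abs, abs_mul] at hω ⊢
    by_contra! hc
    have h5 : |f n ω| < √K := by
      rw [← Real.sqrt_sq_eq_abs]
      exact Real.sqrt_lt_sqrt (sq_nonneg _) hc.1
    have h6 : |f n ω| * |g n ω| < √K * (δ / √K) :=
      mul_lt_mul'' h5 hc.2 (abs_nonneg _) (abs_nonneg _)
    rw [mul_div_cancel₀ _ (by positivity)] at h6
    linarith
  calc _ ≤ _ := measureReal_mono h4
    _ ≤ _ := measureReal_union_le _ _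
    _ < η := by linarith

theorem memLp_mul_of_indepFun {y e : Ω → ℝ} (hy : MemLp y 2 μ) (he : MemLp e 2 μ)
    (h : IndepFun y e μ) : MemLp (fun ω => y ω * e ω) 2 μ := by
  refine (memLp_two_iff_integrable_sq (hy.1.mul he.1)).2 ?_
  have : IndepFun (fun ω => y ω ^ 2) (fun ω => e ω ^ 2) μ :=
    h.comp (φ := fun x => x ^ 2) (ψ := fun x => x ^ 2) (by fun_prop) (by fun_prop)
  refine (this.integrable_mul hy.integrable_sq he.integrable_sq).congr (ae_of_all _ fun ω => ?_)
  simp [mul_pow]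

/-- Orthogonality of the increments `y_i e_i`. -/
theorem memLp_sum_mul_and_integral_sq (F : ℕ → MeasurableSpace Ω)
    (hmono : Monotone F) {y e : ℕ → Ω → ℝ} (hy : ∀ i, Measurable[F i] (y i))
    (he : ∀ i, Measurable[F (i + 1)] (e i))
    (hind : ∀ i, Indep (F i) (MeasurableSpace.comap (e i) inferInstance) μ)
    (hy2 : ∀ i, MemLp (y i) 2 μ) (he2 : ∀ i, MemLp (e i) 2 μ) (h0 : ∀ i, ∫ ω, e i ω ∂μ = 0)
    (n : ℕ) :
    MemLp (fun ω => ∑ i ∈ Finset.range n, y i ω * e i ω) 2 μ ∧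
      ∫ ω, (∑ i ∈ Finset.range n, y i ω * e i ω) ^ 2 ∂μ
        = ∑ i ∈ Finset.range n, (∫ ω, y i ω ^ 2 ∂μ) * ∫ ω, e i ω ^ 2 ∂μ := by
  induction n with
  | zero => simp
  | succ n ih =>
    set S : Ω → ℝ := fun ω => ∑ i ∈ Finset.range n, y i ω * e i ω with hS
    have hSm : Measurable[F n] S := by
      refine Finset.measurable_fun_sum _ fun i hi => ?_
      have hi := Finset.mem_range.1 hi
      exact ((hy i).mono (hmono hi.le) le_rfl).mul ((he i).mono (hmono hi) le_rfl)
    have hI : IndepFun (y n) (e n) μ := indep_of_indep_of_le_left (hind n) (hy n).comap_le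
    have hI2 : IndepFun (fun ω => S ω * y n ω) (e n) μ :=
      indep_of_indep_of_le_left (hind n) (hSm.mul (hy n)).comap_le
    have hye := memLp_mul_of_indepFun (hy2 n) (he2 n) hI
    have hsq : IndepFun (fun ω => y n ω ^ 2) (fun ω => e n ω ^ 2) μ :=
      hI.comp (φ := fun x => x ^ 2) (ψ := fun x => x ^ 2) (by fun_prop) (by fun_prop)
    have e1 : ∫ ω, S ω * y n ω * e n ω ∂μ = 0 := by
      rw [hI2.integral_fun_mul_eq_mul_integral (ih.1.1.mul (hy2 n).1) (he2 n).1, h0, mul_zero]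
    have e2 : ∫ ω, y n ω ^ 2 * e n ω ^ 2 ∂μ = (∫ ω, y n ω ^ 2 ∂μ) * ∫ ω, e n ω ^ 2 ∂μ :=
      hsq.integral_fun_mul_eq_mul_integral ((hy2 n).1.pow 2) ((he2 n).1.pow 2)
    have i1 : Integrable (fun ω => S ω * y n ω * e n ω) μ := by
      refine (ih.1.integrable_mul hye).congr (ae_of_all _ fun ω => ?_)
      simp [mul_assoc, hS]
    have i2 : Integrable (fun ω => y n ω ^ 2 * e n ω ^ 2) μ := by
      refine hye.integrable_sq.congr (ae_of_all _ fun ω => ?_)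
      simp [mul_pow]
    have i0 : Integrable (fun ω => S ω ^ 2) μ := ih.1.integrable_sq
    have i3 : Integrable (fun ω => 2 * (S ω * y n ω * e n ω) + y n ω ^ 2 * e n ω ^ 2) μ :=
      (i1.const_mul 2).add i2
    simp only [Finset.sum_range_succ]
    refine ⟨ih.1.add hye, ?_⟩
    rw [← e2, ← ih.2]
    have : ∀ ω, (∑ i ∈ Finset.range n, y i ω * e i ω + y n ω * e n ω) ^ 2
        = S ω ^ 2 + (2 * (S ω * y n ω * e n ω) + y n ω ^ 2 * e n ω ^ 2) := fun ω => by
      simp only [hS]; ring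
    simp only [this]
    rw [integral_add i0 i3, integral_add (i1.const_mul 2) i2, integral_const_mul, e1]
    ring

/-- Orthogonality of the increments bounds the second moment of the average by `M / n`. -/
theorem tendstoInMeasure_sum_mul_div (F : ℕ → MeasurableSpace Ω)
    (hmono : Monotone F) {y e : ℕ → Ω → ℝ} (hy : ∀ i, Measurable[F i] (y i))
    (he : ∀ i, Measurable[F (i + 1)] (e i))
    (hind : ∀ i, Indep (F i) (MeasurableSpace.comap (e i) inferInstance) μ)
    (hy2 : ∀ i, MemLp (y i) 2 μ) (he2 : ∀ i, MemLp (e i) 2 μ) (h0 : ∀ i, ∫ ω, e i ω ∂μ = 0)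
    {M : ℝ} (hM : ∀ i, (∫ ω, y i ω ^ 2 ∂μ) * ∫ ω, e i ω ^ 2 ∂μ ≤ M) :
    TendstoInMeasure μ (fun n ω => (∑ i ∈ Finset.range n, y i ω * e i ω) / n) atTop
      fun _ => 0 := by
  have key := memLp_sum_mul_and_integral_sq F hmono hy he hind hy2 he2 h0
  refine tendstoInMeasure_zero_of_integral_sq (fun n => ?_) ?_
  · simp only [div_eq_mul_inv]
    exact (key n).1.mul_const _
  · have hlim : Tendsto (fun n : ℕ => M / (n : ℝ)) atTop (𝓝 0) :=
      tendsto_const_div_atTop_nhds_zero_nat M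
    refine squeeze_zero (fun n => integral_nonneg fun _ => sq_nonneg _) (fun n => ?_) hlim
    simp only [div_pow]
    rw [integral_div, (key n).2]
    rcases Nat.eq_zero_or_pos n with rfl | hn
    · simp
    · have hn' : (0 : ℝ) < n := by exact_mod_cast hn
      rw [div_le_div_iff₀ (by positivity) hn']
      have : ∑ i ∈ Finset.range n, (∫ ω, y i ω ^ 2 ∂μ) * ∫ ω, e i ω ^ 2 ∂μ ≤ n * M := by
        refine (Finset.sum_le_sum fun i _ => hM i).trans ?_
        simp
      nlinarith

end SecondMoment

/-! ## Asymptotics of the sums in the least squares estimator -/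

section
variable {Ω : Type u} {ε X : ℤ → Ω → ℝ}

/-- The score sum `∑_{i<n} X_{i+1} ε_{i+2}`. -/
def scoreSum (ε X : ℤ → Ω → ℝ) (n : ℕ) (ω : Ω) : ℝ :=
  ∑ i ∈ Finset.range n, X (i + 1) ω * ε (i + 2) ω

/-- The sum of squares `∑_{i<n} X_{i+1}²`. -/
def squareSum (X : ℤ → Ω → ℝ) (n : ℕ) (ω : Ω) : ℝ := ∑ i ∈ Finset.range n, X (i + 1) ω ^ 2

variable [MeasurableSpace Ω] {μ : Measure Ω} [IsProbabilityMeasure μ] {Θ : Set ℝ} {β₀ : ℝ}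

namespace AR1Model

/-- Stage `i` of the filtration is the past up to time `i + 1`: there `X_{i+1}` is known, while
`ε_{i+2}` is independent of it and becomes known at the next stage. -/
theorem pastSigma_succ_mono : Monotone fun i : ℕ => pastSigma ε X ((i : ℤ) + 1) :=
  fun i j hij => pastSigma_mono (by simpa using hij)

theorem measurable_innov_succ (i : ℕ) :
    Measurable[pastSigma ε X (((i + 1 : ℕ) : ℤ) + 1)] (ε ((i : ℤ) + 2)) :=
  measurable_pastSigma_innov (by push_cast; omega)

theorem integral_innov (hX : AR1Model μ Θ β₀ ε X) (t : ℤ) : ∫ ω, ε t ω ∂μ = 0 :=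
  (hX.innov_identDistrib t).integral_eq.trans hX.innov_mean

theorem integral_innov_sq (hX : AR1Model μ Θ β₀ ε X) (t : ℤ) :
    ∫ ω, ε t ω ^ 2 ∂μ = ∫ ω, ε 0 ω ^ 2 ∂μ :=
  ((hX.innov_identDistrib t).comp (measurable_id.pow_const 2)).integral_eq

theorem integral_sq (hX : AR1Model μ Θ β₀ ε X) (t : ℤ) :
    ∫ ω, X t ω ^ 2 ∂μ = ∫ ω, X 0 ω ^ 2 ∂μ :=
  ((hX.identDistrib t).comp (measurable_id.pow_const 2)).integral_eq

theorem memLp_two (hX : AR1Model μ Θ β₀ ε X) (t : ℤ) : MemLp (X t) 2 μ :=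
  (hX.memLp t).mono_exponent (by norm_num)

theorem memLp_innov_two (hX : AR1Model μ Θ β₀ ε X) (t : ℤ) : MemLp (ε t) 2 μ :=
  (hX.memLp_innov t).mono_exponent (by norm_num)

/-- Square the recursion: the cross term has mean zero by independence, and both squares of `X` have
the same mean by stationarity. -/
theorem variance_eq (hX : AR1Model μ Θ β₀ ε X) :
    (1 - β₀ ^ 2) * ∫ ω, X 0 ω ^ 2 ∂μ = ∫ ω, ε 0 ω ^ 2 ∂μ := by
  have hI : IndepFun (X (0 - 1)) (ε 0) μ :=
    hX.indepFun_of_measurable_past (by norm_num) (measurable_pastSigma_process le_rfl)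
  have h1 := hX.memLp_two (0 - 1)
  have h2 := hX.memLp_innov_two 0
  have e1 : ∫ ω, X (0 - 1) ω * ε 0 ω ∂μ = 0 := by
    rw [hI.integral_fun_mul_eq_mul_integral h1.1 h2.1, hX.innov_mean, mul_zero]
  have i1 : Integrable (fun ω => X (0 - 1) ω * ε 0 ω) μ := h1.integrable_mul h2
  have i2 : Integrable (fun ω => 2 * β₀ * (X (0 - 1) ω * ε 0 ω) + ε 0 ω ^ 2) μ :=
    (i1.const_mul _).add h2.integrable_sq
  have : ∫ ω, X 0 ω ^ 2 ∂μ
      = ∫ ω, (β₀ ^ 2 * X (0 - 1) ω ^ 2 + (2 * β₀ * (X (0 - 1) ω * ε 0 ω) + ε 0 ω ^ 2)) ∂μ := by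
    refine integral_congr_ae ?_
    filter_upwards [hX.recursion 0] with ω hω
    rw [hω]; ring
  rw [integral_add (h1.integrable_sq.const_mul _) i2, integral_add (i1.const_mul _)
    h2.integrable_sq, integral_const_mul, integral_const_mul, e1, hX.integral_sq (0 - 1)] at this
  linarith

theorem secondMoment_pos (hX : AR1Model μ Θ β₀ ε X) : 0 < ∫ ω, X 0 ω ^ 2 ∂μ := by
  have h1 := hX.variance_eq
  have h2 := hX.variance_innov_pos
  have h3 := hX.coeff_sq_lt_one
  rw [← h1] at h2
  exact pos_of_mul_pos_right h2 (by linarith)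

theorem memLp_scoreSum (hX : AR1Model μ Θ β₀ ε X) (n : ℕ) :
    MemLp (scoreSum ε X n) 2 μ ∧ ∫ ω, scoreSum ε X n ω ^ 2 ∂μ
      = n * ((∫ ω, X 0 ω ^ 2 ∂μ) * ∫ ω, ε 0 ω ^ 2 ∂μ) := by
  have := memLp_sum_mul_and_integral_sq (μ := μ) (fun i : ℕ => pastSigma ε X ((i : ℤ) + 1))
    pastSigma_succ_mono (y := fun i => X (i + 1)) (e := fun i => ε (i + 2))
    (fun i => measurable_pastSigma_process le_rfl) measurable_innov_succ
    (fun i => hX.indep_past_innov (by omega)) (fun i => hX.memLp_two _)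
    (fun i => hX.memLp_innov_two _) (fun i => hX.integral_innov _) n
  refine ⟨this.1, this.2.trans ?_⟩
  simp only [hX.integral_sq, hX.integral_innov_sq]
  simp

theorem tendstoInMeasure_scoreSum_div (hX : AR1Model μ Θ β₀ ε X) :
    TendstoInMeasure μ (fun n ω => scoreSum ε X n ω / n) atTop fun _ => 0 :=
  tendstoInMeasure_sum_mul_div (μ := μ) (fun i : ℕ => pastSigma ε X ((i : ℤ) + 1))
    pastSigma_succ_mono (y := fun i => X (i + 1)) (e := fun i => ε (i + 2))
    (fun i => measurable_pastSigma_process le_rfl) measurable_innov_succ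
    (fun i => hX.indep_past_innov (by omega)) (fun i => hX.memLp_two _)
    (fun i => hX.memLp_innov_two _) (fun i => hX.integral_innov _)
    (fun i => by rw [hX.integral_sq, hX.integral_innov_sq])

/-- The weak law for constant weights `1` and the centred squares in the role of innovations; their
square integrability is the fourth moment assumption. -/
theorem tendstoInMeasure_innov_sq (hX : AR1Model μ Θ β₀ ε X) :
    TendstoInMeasure μ (fun n ω => (∑ i ∈ Finset.range n,
      1 * (ε ((i : ℤ) + 2) ω ^ 2 - ∫ ω, ε 0 ω ^ 2 ∂μ)) / (n : ℝ)) atTop fun _ => 0 := by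
  have h4 : ∀ t, MemLp (fun ω => ε t ω ^ 2) 2 μ := fun t => by
    refine (memLp_two_iff_integrable_sq ((hX.innov_measurable t).pow_const 2).aestronglyMeasurable).2 ?_
    have := ((hX.innov_identDistrib t).comp (measurable_id.pow_const 4)).integrable_iff.2
      hX.innov_fourth_moment
    refine this.congr (ae_of_all _ fun ω => ?_)
    simp only [Function.comp, id]; ring
  have hm : ∀ t, MemLp (fun ω => ε t ω ^ 2 - ∫ ω, ε 0 ω ^ 2 ∂μ) 2 μ := fun t =>
    (h4 t).sub (memLp_const _)
  refine tendstoInMeasure_sum_mul_div (μ := μ) (fun i : ℕ => pastSigma ε X ((i : ℤ) + 1))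
    pastSigma_succ_mono (y := fun _ _ => 1) (e := fun i ω => ε (i + 2) ω ^ 2 - ∫ ω, ε 0 ω ^ 2 ∂μ)
    (fun i => measurable_const) (fun i => ((measurable_innov_succ i).pow_const 2).sub_const _)
    (fun i => ?_) (fun i => memLp_const _) (fun i => hm _) (fun i => ?_)
    (M := ∫ ω, (ε 0 ω ^ 2 - ∫ ω, ε 0 ω ^ 2 ∂μ) ^ 2 ∂μ) (fun i => ?_)
  · refine indep_of_indep_of_le_right (hX.indep_past_innov (n := i + 1) (t := i + 2) (by omega)) ?_
    have : Measurable[MeasurableSpace.comap (ε ((i : ℤ) + 2)) inferInstance]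
        fun ω => ε ((i : ℤ) + 2) ω ^ 2 - ∫ ω, ε 0 ω ^ 2 ∂μ :=
      ((comap_measurable (ε ((i : ℤ) + 2))).pow_const 2).sub_const _
    exact this.comap_le
  · rw [integral_sub ((h4 _).integrable (by norm_num)) (integrable_const _), hX.integral_innov_sq]
    simp
  · have := ((hX.innov_identDistrib (i + 2)).comp
      (u := fun x => (x ^ 2 - ∫ ω, ε 0 ω ^ 2 ∂μ) ^ 2) (by fun_prop)).integral_eq
    simp only [Function.comp_def] at this
    rw [this]; simp

theorem tendstoInMeasure_sq_div (hX : AR1Model μ Θ β₀ ε X) (τ : ℕ → ℤ) :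
    TendstoInMeasure μ (fun n ω => X (τ n) ω ^ 2 / (n : ℝ)) atTop fun _ => 0 := by
  refine tendstoInMeasure_of_integral_norm
    (fun n => (hX.memLp_two _).integrable_sq.div_const _) ?_
  have : Tendsto (fun n : ℕ => (∫ ω, X 0 ω ^ 2 ∂μ) / (n : ℝ)) atTop (𝓝 0) :=
    tendsto_const_div_atTop_nhds_zero_nat _
  refine this.congr fun n => ?_
  rw [← hX.integral_sq (τ n), ← integral_div]
  congr 1; ext ω
  rw [Real.norm_of_nonneg (by positivity)]

/-- The squared recursion, summed and telescoped. Divided by `n`, the boundary terms and the score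
vanish in probability and only the average of `ε²` remains. -/
theorem ae_squareSum_eq (hX : AR1Model μ Θ β₀ ε X) :
    ∀ᵐ ω ∂μ, ∀ n : ℕ, (1 - β₀ ^ 2) * squareSum X n ω = X 1 ω ^ 2 - X (n + 1) ω ^ 2
      + 2 * β₀ * scoreSum ε X n ω + ∑ i ∈ Finset.range n, ε ((i : ℤ) + 2) ω ^ 2 := by
  filter_upwards [hX.ae_recursion] with ω hω n
  induction n with
  | zero => simp [squareSum, scoreSum]
  | succ n ih =>
    have h := hω (n + 2)
    rw [show (n : ℤ) + 2 - 1 = n + 1 by ring] at h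
    simp only [squareSum, scoreSum, Finset.sum_range_succ, mul_add] at ih ⊢
    rw [show ((n + 1 : ℕ) : ℤ) + 1 = n + 2 by push_cast; ring, h]
    linear_combination ih

theorem tendstoInMeasure_squareSum_div (hX : AR1Model μ Θ β₀ ε X) :
    TendstoInMeasure μ (fun n ω => squareSum X n ω / n) atTop fun _ => ∫ ω, X 0 ω ^ 2 ∂μ := by
  set γ := ∫ ω, X 0 ω ^ 2 ∂μ with hγ
  set v := ∫ ω, ε 0 ω ^ 2 ∂μ with hv
  have hβ : 0 < 1 - β₀ ^ 2 := by linarith [hX.coeff_sq_lt_one]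
  have h := tendstoInMeasure_zero_const_mul (tendstoInMeasure_zero_add (tendstoInMeasure_zero_add
    (tendstoInMeasure_zero_add (hX.tendstoInMeasure_sq_div fun _ => 1)
      (tendstoInMeasure_zero_const_mul (hX.tendstoInMeasure_sq_div fun n => n + 1) (-1)))
    (tendstoInMeasure_zero_const_mul hX.tendstoInMeasure_scoreSum_div (2 * β₀)))
    hX.tendstoInMeasure_innov_sq) ((1 - β₀ ^ 2)⁻¹)
  have h2 : TendstoInMeasure μ (fun n ω => squareSum X n ω / n - γ) atTop fun _ => 0 := by
    refine h.congr' ?_ (ae_eq_refl _)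
    filter_upwards [eventually_gt_atTop 0] with n hn
    filter_upwards [hX.ae_squareSum_eq] with ω hω
    have hn' : (n : ℝ) ≠ 0 := by exact_mod_cast hn.ne'
    have hv' : (1 - β₀ ^ 2) * γ = v := hX.variance_eq
    have := hω n
    simp only [one_mul, Finset.sum_sub_distrib, Finset.sum_const, Finset.card_range, nsmul_eq_mul]
    rw [inv_mul_eq_iff_eq_mul₀ hβ.ne']
    field_simp
    linear_combination -this + (n : ℝ) * hv'
  have := tendstoInMeasure_comp_continuousAt h2 (g := fun x => x + γ) (by fun_prop)
  simpa using this

theorem tendstoInDistribution_scoreSum (hX : AR1Model μ Θ β₀ ε X) :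
    TendstoInDistribution (fun (n : ℕ) ω => (√(n : ℝ))⁻¹ * scoreSum ε X n ω) atTop
      (id : ℝ → ℝ) (fun _ => μ)
      (gaussianReal 0 ((∫ ω, ε 0 ω ^ 2 ∂μ) * ∫ ω, X 0 ω ^ 2 ∂μ).toNNReal) := by
  have h3 : ∀ t, MemLp (X t) 3 μ := fun t => (hX.memLp t).mono_exponent (by norm_num)
  have := tendstoInDistribution_sum_mul (μ := μ) (fun i : ℕ => pastSigma ε X ((i : ℤ) + 1))
    (fun i => hX.pastSigma_le _)
    pastSigma_succ_mono (y := fun i => X (i + 1)) (e := fun i => ε (i + 2))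
    (fun i => measurable_pastSigma_process le_rfl) measurable_innov_succ
    (fun i => hX.indep_past_innov (by omega))
    (fun i => (hX.innov_identDistrib _).trans (hX.innov_identDistrib _).symm)
    ((hX.memLp_innov _).mono_exponent (by norm_num)) (hX.integral_innov _)
    (M := ∫ ω, |X 0 ω| ^ 3 ∂μ) hX.secondMoment_pos.le
    (fun i => by simpa using (h3 (i + 1)).integrable_norm_pow (p := 3) (by norm_num))
    (fun i => (((hX.identDistrib (i + 1)).comp
      (u := fun x => |x| ^ 3) (by fun_prop)).integral_eq).le)
    hX.tendstoInMeasure_squareSum_div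
  rw [hX.integral_innov_sq] at this
  exact this

end AR1Model
end

/-! ## Further tools for convergence in probability and in distribution -/

section Tools

variable {Ω : Type*} {m0 : MeasurableSpace Ω} {μ : Measure Ω}

theorem tendstoInMeasure_prodMk {f g : ℕ → Ω → ℝ} {a b : ℝ}
    (hf : TendstoInMeasure μ f atTop fun _ => a) (hg : TendstoInMeasure μ g atTop fun _ => b) :
    TendstoInMeasure μ (fun n ω => (f n ω, g n ω)) atTop fun _ => (a, b) := by
  rw [tendstoInMeasure_iff_dist] at hf hg ⊢
  intro δ hδ
  have h := (hf δ hδ).add (hg δ hδ)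
  rw [add_zero] at h
  refine tendsto_of_tendsto_of_tendsto_of_le_of_le tendsto_const_nhds h (fun _ => zero_le)
    fun n => (measure_mono fun ω hω => ?_).trans (measure_union_le _ _)
  simpa [Prod.dist_eq] using hω

theorem tendstoInMeasure_const {c : ℕ → ℝ} {a : ℝ} (h : Tendsto c atTop (𝓝 a)) :
    TendstoInMeasure μ (fun n _ => c n) atTop fun _ => a := by
  rw [tendstoInMeasure_iff_dist]
  intro δ hδ
  refine tendsto_const_nhds.congr' ?_
  filter_upwards [Metric.tendsto_nhds.1 h δ hδ] with n hn
  simp [not_le.2 hn]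

theorem tendstoInMeasure_add_one_iff {f : ℕ → Ω → ℝ} {g : Ω → ℝ} :
    TendstoInMeasure μ (fun n => f (n + 1)) atTop g ↔ TendstoInMeasure μ f atTop g :=
  forall₂_congr fun δ _ => tendsto_add_atTop_iff_nat (f := fun n => μ {x | δ ≤ edist (f n x) (g x)}) 1

theorem tendstoInDistribution_id_of_map_eq [IsProbabilityMeasure μ] {Y : ℕ → Ω → ℝ} {Ω' : Type*}
    {m' : MeasurableSpace Ω'} {ν' : Measure Ω'} [IsProbabilityMeasure ν'] {Z : Ω' → ℝ}
    (h : TendstoInDistribution Y atTop Z (fun _ => μ) ν') {ν : Measure ℝ} [IsProbabilityMeasure ν]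
    (hν : ν'.map Z = ν) : TendstoInDistribution Y atTop (id : ℝ → ℝ) (fun _ => μ) ν := by
  refine ⟨h.forall_aemeasurable, by fun_prop, ?_⟩
  have := h.tendsto
  convert! this using 2
  exact congrArg 𝓝 (Subtype.ext (Measure.map_id.trans hν.symm))

theorem tendstoInDistribution_of_add_one [IsProbabilityMeasure μ] {Y : ℕ → Ω → ℝ} {ν : Measure ℝ}
    [IsProbabilityMeasure ν] (hY : ∀ n, AEMeasurable (Y n) μ)
    (h : TendstoInDistribution (fun n => Y (n + 1)) atTop (id : ℝ → ℝ) (fun _ => μ) ν) :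
    TendstoInDistribution Y atTop (id : ℝ → ℝ) (fun _ => μ) ν :=
  ⟨hY, by fun_prop, (tendsto_add_atTop_iff_nat
    (f := fun n => (⟨μ.map (Y n), Measure.isProbabilityMeasure_map (hY n)⟩ :
      ProbabilityMeasure ℝ)) 1).1 h.tendsto⟩

end Tools

/-! ## Asymptotics of the least squares estimator -/

theorem measurable_olsEstimator (T : ℕ) : Measurable (olsEstimator T) := by
  cases T with
  | zero => exact measurable_const
  | succ n =>
    change Measurable fun x : Fin (n + 1) → ℝ =>
      (∑ i : Fin n, x i.succ * x i.castSucc) / ∑ i : Fin n, x i.castSucc ^ 2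
    fun_prop

section
variable {Ω : Type u} {ε X : ℤ → Ω → ℝ}

/-- The normalized estimation error `√T (βhat(X_{1:T}) - β₀)`. -/
noncomputable def olsError (X : ℤ → Ω → ℝ) (β₀ : ℝ) (T : ℕ) (ω : Ω) : ℝ :=
  √(T : ℝ) * (olsEstimator T (sample X T ω) - β₀)

theorem olsEstimator_succ (X : ℤ → Ω → ℝ) (n : ℕ) (ω : Ω) :
    olsEstimator (n + 1) (sample X (n + 1) ω)
      = (∑ i ∈ Finset.range n, X (i + 2) ω * X (i + 1) ω) / squareSum X n ω := by
  simp only [olsEstimator, sample, squareSum, Fin.val_succ, Fin.val_castSucc]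
  rw [Fin.sum_univ_eq_sum_range (fun i => X ((i + 1 : ℕ) + 1) ω * X (i + 1) ω) n,
    Fin.sum_univ_eq_sum_range (fun i => X (i + 1) ω ^ 2) n]
  congr 1

variable [MeasurableSpace Ω] {μ : Measure Ω} [IsProbabilityMeasure μ] {Θ : Set ℝ} {β₀ : ℝ}

namespace AR1Model

theorem measurable_sample (hX : AR1Model μ Θ β₀ ε X) (T : ℕ) : Measurable (sample X T) :=
  measurable_pi_iff.2 fun _ => hX.measurable _

theorem measurable_olsEstimator (hX : AR1Model μ Θ β₀ ε X) (T : ℕ) :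
    Measurable fun ω => olsEstimator T (sample X T ω) :=
  (TimeSeriesPrediction.measurable_olsEstimator T).comp (hX.measurable_sample T)

theorem measurable_olsError (hX : AR1Model μ Θ β₀ ε X) (T : ℕ) : Measurable (olsError X β₀ T) :=
  ((hX.measurable_olsEstimator T).sub_const _).const_mul _

/-- Since `X_1` has no atom at zero, the denominator is almost surely nonzero for all `n > 0` at
once. A sample of size `n + 1` has `n` summands. -/
theorem ae_olsEstimator_sub (hX : AR1Model μ Θ β₀ ε X) :
    ∀ᵐ ω ∂μ, ∀ n : ℕ, 0 < n → squareSum X n ω ≠ 0 ∧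
      olsEstimator (n + 1) (sample X (n + 1) ω) - β₀ = scoreSum ε X n ω / squareSum X n ω := by
  have h1 : ∀ᵐ ω ∂μ, X 1 ω ≠ 0 := by
    simpa [ae_iff] using hX.measure_eq_zero 1 0
  filter_upwards [hX.ae_recursion, h1] with ω hω h1 n hn
  have hQ : squareSum X n ω ≠ 0 := by
    refine (lt_of_lt_of_le (by positivity : 0 < X 1 ω ^ 2) ?_).ne'
    have := Finset.single_le_sum (f := fun i : ℕ => X ((i : ℤ) + 1) ω ^ 2)
      (fun i _ => sq_nonneg _) (Finset.mem_range.2 hn)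
    simpa [squareSum] using this
  refine ⟨hQ, ?_⟩
  have : ∑ i ∈ Finset.range n, X (i + 2) ω * X (i + 1) ω
      = β₀ * squareSum X n ω + scoreSum ε X n ω := by
    simp only [squareSum, scoreSum]
    rw [Finset.mul_sum, ← Finset.sum_add_distrib]
    refine Finset.sum_congr rfl fun i _ => ?_
    rw [hω (i + 2), show (i : ℤ) + 2 - 1 = i + 1 by ring]
    ring
  rw [olsEstimator_succ, this]
  field_simp
  ring

theorem tendstoInMeasure_olsEstimator (hX : AR1Model μ Θ β₀ ε X) :
    TendstoInMeasure μ (fun T ω => olsEstimator T (sample X T ω)) atTop fun _ => β₀ := by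
  rw [← tendstoInMeasure_add_one_iff]
  have h := tendstoInMeasure_comp_continuousAt (tendstoInMeasure_prodMk
    hX.tendstoInMeasure_scoreSum_div hX.tendstoInMeasure_squareSum_div)
    (g := fun p : ℝ × ℝ => p.1 / p.2 + β₀)
    ((continuousAt_fst.div continuousAt_snd hX.secondMoment_pos.ne').add continuousAt_const)
  simp only [zero_div, zero_add] at h
  refine h.congr' ?_ (ae_eq_refl _)
  filter_upwards [eventually_gt_atTop 0] with n hn
  filter_upwards [hX.ae_olsEstimator_sub] with ω hω
  obtain ⟨hQ, h⟩ := hω n hn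
  have hn' : (n : ℝ) ≠ 0 := by exact_mod_cast hn.ne'
  rw [div_div_div_cancel_right₀ hn', ← h, sub_add_cancel]

theorem tendsto_sqrt_succ_div : Tendsto (fun n : ℕ => √((n : ℝ) + 1) / √(n : ℝ)) atTop (𝓝 1) := by
  have h : Tendsto (fun n : ℕ => √(1 + 1 / (n : ℝ))) atTop (𝓝 √(1 + 0)) :=
    (tendsto_const_nhds.add tendsto_one_div_atTop_nhds_zero_nat).sqrt
  rw [add_zero, Real.sqrt_one] at h
  refine h.congr' ?_
  filter_upwards [eventually_gt_atTop 0] with n hn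
  have hn' : (0 : ℝ) < n := by exact_mod_cast hn
  rw [← Real.sqrt_div (by positivity)]
  congr 1
  field_simp

theorem memLp_normalized_scoreSum (hX : AR1Model μ Θ β₀ ε X) (n : ℕ) :
    MemLp (fun ω => (√(n : ℝ))⁻¹ * scoreSum ε X n ω) 2 μ ∧
      ∫ ω, ((√(n : ℝ))⁻¹ * scoreSum ε X n ω) ^ 2 ∂μ
        ≤ (∫ ω, X 0 ω ^ 2 ∂μ) * ∫ ω, ε 0 ω ^ 2 ∂μ := by
  obtain ⟨h1, h2⟩ := hX.memLp_scoreSum n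
  refine ⟨h1.const_mul _, ?_⟩
  simp only [mul_pow, inv_pow, Real.sq_sqrt (Nat.cast_nonneg n)]
  rw [integral_const_mul, h2, ← mul_assoc]
  exact mul_le_of_le_one_left (mul_nonneg hX.secondMoment_pos.le hX.variance_innov_pos.le)
    (inv_mul_le_one_of_le₀ le_rfl (Nat.cast_nonneg n))

/-- The estimation error is asymptotically linear in the innovations. -/
theorem tendstoInMeasure_olsError_sub (hX : AR1Model μ Θ β₀ ε X) :
    TendstoInMeasure μ (fun n ω => olsError X β₀ (n + 1) ω
      - (∫ ω, X 0 ω ^ 2 ∂μ)⁻¹ * ((√(n : ℝ))⁻¹ * scoreSum ε X n ω)) atTop fun _ => 0 := by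
  set γ := ∫ ω, X 0 ω ^ 2 ∂μ with hγ
  have hγ0 : γ ≠ 0 := hX.secondMoment_pos.ne'
  -- The difference to be bounded is this factor times the normalized score, which is bounded in
  -- `L²`.
  have h1 : TendstoInMeasure μ (fun (n : ℕ) ω => √((n : ℝ) + 1) / √(n : ℝ) / (squareSum X n ω / n) - γ⁻¹)
      atTop fun _ => 0 := by
    have := tendstoInMeasure_comp_continuousAt (tendstoInMeasure_prodMk
      (tendstoInMeasure_const tendsto_sqrt_succ_div) hX.tendstoInMeasure_squareSum_div)
      (g := fun p : ℝ × ℝ => p.1 / p.2 - γ⁻¹)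
      ((continuousAt_fst.div continuousAt_snd hγ0).sub continuousAt_const)
    simpa [← hγ] using this
  have h2 := tendstoInMeasure_zero_mul_of_integral_sq_le
    (fun n => (hX.memLp_normalized_scoreSum n).1) (fun n => (hX.memLp_normalized_scoreSum n).2) h1
  refine h2.congr' ?_ (ae_eq_refl _)
  filter_upwards [eventually_gt_atTop 0] with n hn
  filter_upwards [hX.ae_olsEstimator_sub] with ω hω
  obtain ⟨hQ, h⟩ := hω n hn
  have hn' : (0 : ℝ) < n := by exact_mod_cast hn
  have hs : √(n : ℝ) ≠ 0 := by positivity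
  have hsq : (n : ℝ) = √(n : ℝ) ^ 2 := (Real.sq_sqrt hn'.le).symm
  rw [olsError, h]
  push_cast
  rw [div_div_eq_mul_div]
  nth_rewrite 4 [hsq]
  field_simp

theorem tendstoInDistribution_olsError (hX : AR1Model μ Θ β₀ ε X) :
    TendstoInDistribution (olsError X β₀) atTop (id : ℝ → ℝ) (fun _ => μ)
      (gaussianReal 0 (1 - β₀ ^ 2).toNNReal) := by
  refine tendstoInDistribution_of_add_one (fun n => (hX.measurable_olsError n).aemeasurable) ?_
  set γ := ∫ ω, X 0 ω ^ 2 ∂μ with hγ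
  have hγ0 : 0 < γ := hX.secondMoment_pos
  have h1 := hX.tendstoInDistribution_scoreSum.continuous_comp (g := fun x => γ⁻¹ * x) (by fun_prop)
  have h2 := tendstoInDistribution_of_tendstoInMeasure_sub
    (fun n => olsError X β₀ (n + 1)) _ h1 (by
      have := hX.tendstoInMeasure_olsError_sub
      exact this) (fun n => (hX.measurable_olsError _).aemeasurable)
  refine tendstoInDistribution_id_of_map_eq h2 ?_
  have : ((fun x => γ⁻¹ * x) ∘ (id : ℝ → ℝ)) = fun x => γ⁻¹ * x := rfl
  rw [this, gaussianReal_map_const_mul, mul_zero]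
  congr 1
  refine NNReal.eq ?_
  have hβ := hX.coeff_sq_lt_one
  have hv := hX.variance_eq
  have hv0 := hX.variance_innov_pos
  rw [NNReal.coe_mul, Real.coe_toNNReal _ (mul_nonneg hv0.le hγ0.le),
    Real.coe_toNNReal _ (by linarith), ← hv]
  simp only [NNReal.coe_mk]
  rw [← hγ]
  field_simp

/-- Both errors are asymptotically `γ⁻¹` times a normalized score. One more observation adds a
single term of order `n^(-1/2)` and rescales by a factor tending to one. -/
theorem tendstoInMeasure_olsError_succ_sub (hX : AR1Model μ Θ β₀ ε X) :
    TendstoInMeasure μ (fun T ω => olsError X β₀ (T + 1) ω - olsError X β₀ T ω) atTop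
      fun _ => 0 := by
  rw [← tendstoInMeasure_add_one_iff]
  set γ := ∫ ω, X 0 ω ^ 2 ∂μ with hγ
  have hD := hX.tendstoInMeasure_olsError_sub
  have hD1 := tendstoInMeasure_add_one_iff.2 hD
  have hinc : TendstoInMeasure μ (fun (n : ℕ) ω => (√((n : ℝ) + 1))⁻¹
      * (X (n + 1) ω * ε (n + 2) ω)) atTop fun _ => 0 := by
    have hI : ∀ n : ℕ, IndepFun (X (n + 1)) (ε (n + 2)) μ := fun n =>
      hX.indepFun_of_measurable_past (by omega) (measurable_pastSigma_process le_rfl)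
    refine tendstoInMeasure_zero_of_integral_sq (fun n =>
      (memLp_mul_of_indepFun (hX.memLp_two _) (hX.memLp_innov_two _) (hI n)).const_mul _) ?_
    have h0 : Tendsto (fun n : ℕ => 1 / ((n : ℝ) + 1) * (γ * ∫ ω, ε 0 ω ^ 2 ∂μ)) atTop (𝓝 0) := by
      simpa using (tendsto_one_div_add_atTop_nhds_zero_nat (𝕜 := ℝ)).mul_const
        (γ * ∫ ω, ε 0 ω ^ 2 ∂μ)
    refine h0.congr fun n => ?_
    have hsq : IndepFun (fun ω => X (n + 1) ω ^ 2) (fun ω => ε (n + 2) ω ^ 2) μ :=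
      (hI n).comp (φ := fun x => x ^ 2) (ψ := fun x => x ^ 2) (by fun_prop) (by fun_prop)
    simp only [mul_pow, inv_pow, Real.sq_sqrt (by positivity : 0 ≤ (n : ℝ) + 1)]
    rw [integral_const_mul, hsq.integral_fun_mul_eq_mul_integral ((hX.memLp_two _).1.pow 2)
      ((hX.memLp_innov_two _).1.pow 2), hX.integral_sq, hX.integral_innov_sq (n + 2), one_div]
  have hratio : TendstoInMeasure μ (fun (n : ℕ) (_ : Ω) => √(n : ℝ) / √((n : ℝ) + 1) - 1) atTop
      fun _ => 0 := by
    refine tendstoInMeasure_const ?_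
    have := (tendsto_sqrt_succ_div.inv₀ one_ne_zero).sub_const 1
    simpa using this
  have hold := tendstoInMeasure_zero_mul_of_integral_sq_le
    (fun n => (hX.memLp_normalized_scoreSum n).1) (fun n => (hX.memLp_normalized_scoreSum n).2)
    hratio
  have h := tendstoInMeasure_zero_add
    (tendstoInMeasure_zero_add hD1 (tendstoInMeasure_zero_const_mul hD (-1)))
    (tendstoInMeasure_zero_const_mul (tendstoInMeasure_zero_add hinc hold) γ⁻¹)
  refine h.congr' ?_ (ae_eq_refl _)
  filter_upwards [eventually_gt_atTop 0] with n hn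
  refine Eventually.of_forall fun ω => ?_
  have hn' : (0 : ℝ) < n := by exact_mod_cast hn
  have hs : √(n : ℝ) ≠ 0 := by positivity
  have hs1 : √((n : ℝ) + 1) ≠ 0 := by positivity
  have hS : scoreSum ε X (n + 1) ω = scoreSum ε X n ω + X (n + 1) ω * ε (n + 2) ω := by
    simp [scoreSum, Finset.sum_range_succ]
  simp only [hS]
  push_cast
  field_simp
  ring

theorem tendstoInMeasure_olsError_add_sub (hX : AR1Model μ Θ β₀ ε X) (k : ℕ) :
    TendstoInMeasure μ (fun T ω => olsError X β₀ (T + k) ω - olsError X β₀ T ω) atTop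
      fun _ => 0 := by
  induction k with
  | zero =>
    simp only [add_zero, sub_self]
    exact tendstoInMeasure_const tendsto_const_nhds
  | succ k ih =>
    have h1 : TendstoInMeasure μ
        (fun T ω => olsError X β₀ (T + k + 1) ω - olsError X β₀ (T + k) ω) atTop fun _ => 0 :=
      hX.tendstoInMeasure_olsError_succ_sub.comp (tendsto_add_atTop_nat k)
    have := tendstoInMeasure_zero_add h1 ih
    simp only [sub_add_sub_cancel] at this
    exact this

end AR1Model
end

/-! ## Weak dependence of the estimation error and a later block -/

section CondDistrib

variable {Ω : Type*} [MeasurableSpace Ω] {μ : Measure Ω} [IsProbabilityMeasure μ]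
  {E : Type*} [MeasurableSpace E]

/-- The mean deviation of a conditional expectation from the expectation is a covariance. -/
theorem exists_integral_abs_condDistrib_sub_eq {A : Ω → ℝ} {B : Ω → E} (hA : Measurable A)
    (hB : Measurable B) {h : ℝ → ℝ} (hh : Measurable h) {C : ℝ} (hC : ∀ x, |h x| ≤ C) :
    ∃ ψ : E → ℝ, Measurable ψ ∧ (∀ b, |ψ b| ≤ 1) ∧
      Integrable (fun ω => ∫ y, h y ∂(condDistrib A B μ (B ω)) - ∫ y, h y ∂(μ.map A)) μ ∧
      ∫ ω, |∫ y, h y ∂(condDistrib A B μ (B ω)) - ∫ y, h y ∂(μ.map A)| ∂μ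
        = ∫ ω, h (A ω) * ψ (B ω) ∂μ - (∫ ω, h (A ω) ∂μ) * ∫ ω, ψ (B ω) ∂μ := by
  have hc : ∫ y, h y ∂(μ.map A) = ∫ ω, h (A ω) ∂μ :=
    integral_map hA.aemeasurable hh.aestronglyMeasurable
  set c := ∫ ω, h (A ω) ∂μ with hcdef
  set φ : E → ℝ := fun b => ∫ y, h y ∂(condDistrib A B μ b) - c with hφ
  have hφ0 : Measurable fun b => ∫ y, h y ∂(condDistrib A B μ b) := by
    have : StronglyMeasurable (Function.uncurry fun (_ : E) (y : ℝ) => h y) :=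
      (hh.comp measurable_snd).stronglyMeasurable
    exact this.integral_kernel_prod_right.measurable
  have hφm : Measurable φ := hφ0.sub_const c
  -- The sign of the deviation `φ`, so that `|φ| = φ ψ`; as a function of `B` it may be moved inside
  -- the conditional expectation.
  set ψ : E → ℝ := fun b => if 0 ≤ φ b then 1 else -1 with hψ
  have hψm : Measurable ψ :=
    Measurable.ite (measurableSet_le measurable_const hφm) measurable_const measurable_const
  have hψ1 : ∀ b, |ψ b| ≤ 1 := fun b => by simp only [hψ]; split_ifs <;> simp
  have hψφ : ∀ b, |φ b| = φ b * ψ b := fun b => by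
    simp only [hψ]
    split_ifs with h0
    · rw [abs_of_nonneg h0, mul_one]
    · rw [abs_of_neg (not_le.1 h0), mul_neg_one]
  have hb0 : ∀ b, |∫ y, h y ∂(condDistrib A B μ b)| ≤ C := fun b => abs_integral_le_of_abs_le hC
  have hi0 : Integrable (fun ω => ∫ y, h y ∂(condDistrib A B μ (B ω))) μ :=
    Integrable.of_bound (hφ0.comp hB).aestronglyMeasurable C (ae_of_all _ fun _ => hb0 _)
  have hiψ : Integrable (fun ω => ψ (B ω)) μ :=
    Integrable.of_bound (hψm.comp hB).aestronglyMeasurable 1 (ae_of_all _ fun _ => hψ1 _)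
  have hi1 : Integrable (fun ω => ψ (B ω) * ∫ y, h y ∂(condDistrib A B μ (B ω))) μ :=
    hi0.bdd_mul (hψm.comp hB).aestronglyMeasurable (ae_of_all _ fun _ => hψ1 _)
  refine ⟨ψ, hψm, hψ1, hi0.sub (integrable_const _), ?_⟩
  have hce := condExp_prod_ae_eq_integral_condDistrib (μ := μ) hB hA.aemeasurable
    (f := fun p : E × ℝ => ψ p.1 * h p.2) (Measurable.stronglyMeasurable (by fun_prop))
    (Integrable.of_bound (Measurable.aestronglyMeasurable (by fun_prop)) (1 * C)
      (ae_of_all _ fun ω => by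
        rw [norm_mul]
        exact mul_le_mul (hψ1 _) (hC _) (norm_nonneg _) zero_le_one))
  have hint := integral_congr_ae hce
  rw [integral_condExp hB.comap_le] at hint
  simp only [integral_const_mul] at hint
  rw [hc]
  have : ∀ ω, |∫ y, h y ∂(condDistrib A B μ (B ω)) - c|
      = ψ (B ω) * (∫ y, h y ∂(condDistrib A B μ (B ω))) - c * ψ (B ω) := fun ω => by
    have := hψφ (B ω)
    simp only [hφ] at this
    rw [this]; ring
  simp only [this]
  rw [integral_sub hi1 (hiψ.const_mul c), ← hint, integral_const_mul]
  congr 2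
  ext ω
  ring

end CondDistrib

section
variable {Ω : Type u} {ε X : ℤ → Ω → ℝ}
variable [MeasurableSpace Ω] {μ : Measure Ω} [IsProbabilityMeasure μ] {Θ : Set ℝ} {β₀ : ℝ}

theorem measurable_block {X : ℤ → Ω → ℝ} (hX : ∀ t, Measurable (X t)) (a b : ℕ) :
    Measurable (block X a b) :=
  measurable_pi_iff.2 fun _ => hX _

namespace AR1Model

theorem integral_translateDist_eq (hX : AR1Model μ Θ β₀ ε X) {f : ℝ → ℝ} (hf : Measurable f)
    (c : ℝ) (t : ℤ) :
    ∫ ω, translateDist f (c * X t ω) ∂μ = ∫ ω, translateDist f (c * X 0 ω) ∂μ :=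
  ((hX.identDistrib t).comp
    ((measurable_translateDist hf).comp (measurable_id.const_mul c))).integral_eq

theorem tendsto_integral_translateDist (hX : AR1Model μ Θ β₀ ε X) {f : ℝ → ℝ} (hf : Measurable f)
    (hfi : Integrable f) :
    Tendsto (fun j : ℕ => ∫ ω, translateDist f (β₀ ^ j * X 0 ω) ∂μ) atTop (𝓝 0) := by
  have h := tendsto_integral_of_dominated_convergence (μ := μ)
    (F := fun (j : ℕ) ω => translateDist f (β₀ ^ j * X 0 ω)) (f := fun _ => 0)
    (fun _ => 2 * ∫ x, |f x|)
    (fun j => ((measurable_translateDist hf).comp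
      ((hX.measurable 0).const_mul _)).aestronglyMeasurable) (integrable_const _)
    (fun j => ae_of_all _ fun ω => by
      rw [Real.norm_of_nonneg (translateDist_nonneg _ _)]; exact translateDist_le hfi _)
    (ae_of_all _ fun ω => by
      refine (tendsto_translateDist hfi).comp ?_
      simpa using (tendsto_pow_atTop_nhds_zero_of_abs_lt_one hX.abs_coeff_lt_one).mul_const (X 0 ω))
  simpa using h

/-- Bounded functions of the estimation error at time `n` and of the block from time `n + m + 1` on
are nearly uncorrelated for large `m`. -/
theorem abs_covariance_olsError_block_le (hX : AR1Model μ Θ β₀ ε X) {f : ℝ → ℝ}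
    (hf : Measurable f) (hf0 : ∀ x, 0 ≤ f x)
    (hlaw : μ.map (ε 0) = volume.withDensity fun x => ENNReal.ofReal (f x))
    {h : ℝ → ℝ} (hh : Measurable h) {C : ℝ} (hC : ∀ x, |h x| ≤ C) (n m : ℕ) {N : ℤ}
    (hN : N = n + m + 1) (T : ℤ) {ψ : (Set.Icc N T → ℝ) → ℝ} (hψ : Measurable ψ)
    (hψ1 : ∀ b, |ψ b| ≤ 1) :
    |∫ ω, h (olsError X β₀ n ω) * ψ (fun t => X t ω) ∂μ
        - (∫ ω, h (olsError X β₀ n ω) ∂μ) * ∫ ω, ψ (fun t => X t ω) ∂μ|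
      ≤ 2 * C * ∫ ω, translateDist f (β₀ ^ (m + 1) * X 0 ω) ∂μ := by
  set U : Ω → (Set.Iic (n : ℤ) → ℝ × ℝ) := fun ω s => (X s ω, ε s ω) with hU
  -- `ε N` is singled out to supply the density. `R` collects the other innovations after `n`: the
  -- part of `X_N` due to times `n + 1, …, N - 1`, and the part of each `X_t` due to times after
  -- `N`.
  set R : Ω → ℝ × (Set.Icc N T → ℝ) := fun ω =>
    (∑ i ∈ Finset.range m, β₀ ^ (i + 1) * ε (N - (i + 1)) ω,
      fun t => ∑ i ∈ Finset.range ((t : ℤ) - N).toNat, β₀ ^ i * ε (t - i) ω) with hR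
  have hRS : Measurable[innovSigma ε (Set.Ioi (n : ℤ) \ {N})] R := by
    refine Measurable.prodMk (Finset.measurable_fun_sum _ fun i hi => ?_)
      (measurable_of_forall_apply fun t => Finset.measurable_fun_sum _ fun i hi => ?_)
    · refine (measurable_innovSigma ?_).const_mul _
      have := Finset.mem_range.1 hi
      simp only [Set.mem_sdiff, Set.mem_Ioi, Set.mem_singleton_iff]
      omega
    · refine (measurable_innovSigma ?_).const_mul _
      have := Finset.mem_range.1 hi
      simp only [Set.mem_sdiff, Set.mem_Ioi, Set.mem_singleton_iff]
      omega
  have hξS : Measurable[innovSigma ε {N}] (ε N) := measurable_innovSigma rfl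
  have hRm : Measurable R := hRS.mono (hX.innovSigma_le _) le_rfl
  have hξm : Measurable (ε N) := hX.innov_measurable N
  have hUm : Measurable U := hX.measurable_pair _
  have hξR : IndepFun (ε N) R μ :=
    indep_of_indep_of_le (hX.indep_innovSigma
      (S := {N}) (T := Set.Ioi (n : ℤ) \ {N}) Set.disjoint_sdiff_right) hξS.comap_le hRS.comap_le
  have hUξR : IndepFun U (fun ω => (ε N ω, R ω)) μ := by
    refine hX.indepFun_past_future n (Measurable.prodMk ?_ ?_)
    · refine hξS.mono (innovSigma_mono ?_) le_rfl
      simp only [Set.singleton_subset_iff, Set.mem_Ioi]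
      omega
    · exact hRS.mono (innovSigma_mono Set.sdiff_subset) le_rfl
  set g : (Set.Iic (n : ℤ) → ℝ × ℝ) → ℝ := fun u =>
    h (√(n : ℝ) * (olsEstimator n (fun i => (u ⟨(i : ℕ) + 1, by
      have := i.2; simp only [Set.mem_Iic]; omega⟩).1) - β₀)) with hg
  have hgm : Measurable g := by
    refine hh.comp (Measurable.const_mul (Measurable.sub_const
      ((TimeSeriesPrediction.measurable_olsEstimator n).comp ?_) _) _)
    exact measurable_pi_iff.2 fun i => measurable_fst.comp (measurable_pi_apply _)
  set a : (Set.Iic (n : ℤ) → ℝ × ℝ) → ℝ := fun u => β₀ ^ (m + 1) * (u ⟨n, Set.mem_Iic.2 le_rfl⟩).1 with ha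
  have ham : Measurable a := (measurable_fst.comp (measurable_pi_apply _)).const_mul _
  -- Rebuilds the block from `X_t = β₀^(t-N) X_N + R.2 t`, where `X_N = β₀^(m+1) X_n + ε_N + R.1`;
  -- the past enters only through the shift of `ε_N`.
  set Ψ : ℝ × (ℝ × (Set.Icc N T → ℝ)) → ℝ := fun p =>
    ψ fun t => β₀ ^ ((t : ℤ) - N).toNat * (p.1 + p.2.1) + p.2.2 t with hΨ
  have hΨm : Measurable Ψ := by
    refine hψ.comp (measurable_pi_iff.2 fun t => ?_)
    fun_prop
  have key := abs_covariance_shift_le hUm hξm hRm hUξR hξR hf hf0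
    ((hX.innov_identDistrib N).map_eq.trans hlaw) hΨm (fun _ => hψ1 _) ham hgm
    (fun _ => hC _)
  have e1 : ∀ ω, g (U ω) = h (olsError X β₀ n ω) := fun ω => rfl
  have e2 : ∀ᵐ ω ∂μ, Ψ (a (U ω) + ε N ω, R ω) = ψ (fun t => X t ω) := by
    filter_upwards [hX.ae_iterate] with ω hω
    simp only [hΨ]
    congr 1
    ext t
    have ht : N ≤ (t : ℤ) := t.2.1
    have h1 := hω ((t : ℤ) - N).toNat t
    have h2 := hω (m + 1) N
    rw [Finset.sum_range_succ'] at h2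
    rw [show (t : ℤ) - (((t : ℤ) - N).toNat : ℤ) = N by omega, h2] at h1
    rw [show N - ((m + 1 : ℕ) : ℤ) = n by rw [hN]; push_cast; ring] at h1
    simp only [hR, ha, hU]
    rw [h1]
    simp only [pow_zero, one_mul, Nat.cast_zero, sub_zero]
    push_cast
    ring
  simp only [e1] at key
  have e3 : ∫ ω, h (olsError X β₀ n ω) * Ψ (a (U ω) + ε N ω, R ω) ∂μ
      = ∫ ω, h (olsError X β₀ n ω) * ψ (fun t => X t ω) ∂μ := by
    refine integral_congr_ae ?_
    filter_upwards [e2] with ω hω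
    rw [hω]
  rw [e3, integral_congr_ae e2] at key
  refine key.trans_eq ?_
  simp only [ha, hU]
  rw [hX.integral_translateDist_eq hf]

/-- Replacing the error at `n + k` by the one at `n` in each of the two terms of the covariance
costs one `L¹` distance each; what remains is a covariance across a gap of `m + 1`. -/
theorem integral_abs_condDistrib_sub_le (hX : AR1Model μ Θ β₀ ε X) {f : ℝ → ℝ}
    (hf : Measurable f) (hf0 : ∀ x, 0 ≤ f x)
    (hlaw : μ.map (ε 0) = volume.withDensity fun x => ENNReal.ofReal (f x))
    {h : ℝ → ℝ} (hh : Measurable h) {C : ℝ} (hC : ∀ x, |h x| ≤ C) (n k m T : ℕ) :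
    ∫ ω, |∫ y, h y ∂(condDistrib (olsError X β₀ (n + k)) (block X (n + m + 1) T) μ
        (block X (n + m + 1) T ω)) - ∫ y, h y ∂(μ.map (olsError X β₀ (n + k)))| ∂μ
      ≤ 2 * ∫ ω, |h (olsError X β₀ (n + k) ω) - h (olsError X β₀ n ω)| ∂μ
        + 2 * C * ∫ ω, translateDist f (β₀ ^ (m + 1) * X 0 ω) ∂μ := by
  have hbm := measurable_block hX.measurable (n + m + 1) T
  obtain ⟨ψ, hψ, hψ1, -, heq⟩ := exists_integral_abs_condDistrib_sub_eq (μ := μ)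
    (hX.measurable_olsError (n + k)) hbm hh hC
  rw [heq]
  have hcov : |∫ ω, h (olsError X β₀ n ω) * ψ (block X (n + m + 1) T ω) ∂μ
        - (∫ ω, h (olsError X β₀ n ω) ∂μ) * ∫ ω, ψ (block X (n + m + 1) T ω) ∂μ|
      ≤ 2 * C * ∫ ω, translateDist f (β₀ ^ (m + 1) * X 0 ω) ∂μ := hX.abs_covariance_olsError_block_le hf hf0 hlaw hh hC n m
    (by push_cast; ring) T hψ hψ1
  set B := block X (n + m + 1) T with hB
  have hhm : ∀ j, Measurable fun ω => h (olsError X β₀ j ω) := fun j =>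
    hh.comp (hX.measurable_olsError j)
  have hhi : ∀ j, Integrable (fun ω => h (olsError X β₀ j ω)) μ := fun j =>
    Integrable.of_bound (hhm j).aestronglyMeasurable C (ae_of_all _ fun _ => hC _)
  have hhψ : ∀ j, Integrable (fun ω => h (olsError X β₀ j ω) * ψ (B ω)) μ := fun j =>
    (hhi j).mul_bdd (c := 1) (hψ.comp hbm).aestronglyMeasurable (ae_of_all _ fun _ => hψ1 _)
  set δ := ∫ ω, |h (olsError X β₀ (n + k) ω) - h (olsError X β₀ n ω)| ∂μ with hδ
  have hdi := ((hhi (n + k)).sub (hhi n)).abs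
  have b1 : |∫ ω, h (olsError X β₀ (n + k) ω) * ψ (B ω) ∂μ
      - ∫ ω, h (olsError X β₀ n ω) * ψ (B ω) ∂μ| ≤ δ := by
    rw [← integral_sub (hhψ _) (hhψ _), ← Real.norm_eq_abs]
    refine norm_integral_le_of_norm_le hdi (ae_of_all _ fun ω => ?_)
    rw [← sub_mul, norm_mul]
    exact mul_le_of_le_one_right (norm_nonneg _) (hψ1 _)
  have b2 : |∫ ω, h (olsError X β₀ (n + k) ω) ∂μ - ∫ ω, h (olsError X β₀ n ω) ∂μ| ≤ δ := by
    rw [← integral_sub (hhi _) (hhi _), ← Real.norm_eq_abs]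
    exact norm_integral_le_of_norm_le hdi (ae_of_all _ fun ω => le_rfl)
  have b3 : |∫ ω, ψ (B ω) ∂μ| ≤ 1 := abs_integral_le_of_abs_le fun _ => hψ1 _
  have b4 : |(∫ ω, h (olsError X β₀ (n + k) ω) ∂μ - ∫ ω, h (olsError X β₀ n ω) ∂μ)
      * ∫ ω, ψ (B ω) ∂μ| ≤ δ := by
    rw [abs_mul]
    exact (mul_le_of_le_one_right (abs_nonneg _) b3).trans b2
  have c1 := (abs_le.1 b1).2
  have c2 := (abs_le.1 b4).1
  have c3 := (abs_le.1 hcov).2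
  linarith

theorem weakDependence (hX : AR1Model μ Θ β₀ ε X) {TE TP : ℕ → ℕ} (hlt : ∀ T, TE T < TP T)
    (hTE : Tendsto TE atTop atTop) :
    WeakDependence μ X β₀ olsEstimator (fun T => √(T : ℝ)) TE TP := by
  rintro h ⟨⟨C, hC⟩, K, hK⟩ A
  obtain ⟨f, hf, hfpos, hlaw⟩ := hX.innov_density
  have hf0 : ∀ x, 0 ≤ f x := fun x => (hfpos x).le
  have hfi := integrable_density (hX.innov_measurable 0) hf hf0 hlaw
  have hh : Measurable h := hK.continuous.measurable
  have hA : ∀ T, A T = olsError X β₀ (TE T) := fun T => rfl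
  refine tendstoInMeasure_of_integral_norm (fun T => ?_) ?_
  · obtain ⟨-, -, -, hi, -⟩ := exists_integral_abs_condDistrib_sub_eq (μ := μ)
      (hX.measurable_olsError (TE T)) (measurable_block hX.measurable (TP T) T) hh hC
    exact hi
  have hC0 : 0 ≤ C := (abs_nonneg _).trans (hC 0)
  rw [Metric.tendsto_atTop]
  intro η hη
  -- `k` is fixed before `T`. With this tolerance `2 * C` times the translation term stays below `η
  -- / 2`, also when `C = 0`; the other half of `η` goes to the cost of dropping `k` observations.
  obtain ⟨k, hk⟩ := Metric.tendsto_atTop.1 (hX.tendsto_integral_translateDist hf hfi)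
    (η / (4 * (C + 1))) (by positivity)
  have hdiff : Tendsto (fun n => ∫ ω, ‖h (olsError X β₀ (n + k) ω) - h (olsError X β₀ n ω)‖ ∂μ)
      atTop (𝓝 0) := by
    refine tendsto_integral_norm_of_tendstoInMeasure (B := C + C) (fun n => ?_) (fun n ω => ?_) ?_
    · exact ((hh.comp (hX.measurable_olsError _)).sub
        (hh.comp (hX.measurable_olsError _))).aestronglyMeasurable
    · exact (norm_sub_le _ _).trans (add_le_add (hC _) (hC _))
    · refine tendstoInMeasure_of_dist_lt (hX.tendstoInMeasure_olsError_add_sub k) fun δ hδ =>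
        ⟨δ / (K + 1), by positivity, Eventually.of_forall fun n ω hω => ?_⟩
      rw [dist_zero_right] at hω ⊢
      rw [lt_div_iff₀ (by positivity)] at hω
      have := hK.norm_sub_le (olsError X β₀ (n + k) ω) (olsError X β₀ n ω)
      nlinarith [norm_nonneg (olsError X β₀ (n + k) ω - olsError X β₀ n ω)]
  obtain ⟨n₀, hn₀⟩ := Metric.tendsto_atTop.1 hdiff (η / 4) (by positivity)
  obtain ⟨T₀, hT₀⟩ := eventually_atTop.1 (hTE.eventually_ge_atTop (n₀ + k))
  refine ⟨T₀, fun T hT => ?_⟩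
  obtain ⟨n, hn⟩ : ∃ n, TE T = n + k := ⟨TE T - k, by have := hT₀ T hT; omega⟩
  -- The created gap is `m + 1 = TP T - TE T + k`, so it exceeds `k` however small the original gap
  -- is.
  obtain ⟨m, hm⟩ : ∃ m, TP T = n + m + 1 := ⟨TP T - n - 1, by have := hlt T; omega⟩
  have hmk : k ≤ m + 1 := by have := hlt T; omega
  have hnn : n₀ ≤ n := by have := hT₀ T hT; omega
  have h1 := hX.integral_abs_condDistrib_sub_le hf hf0 hlaw hh hC n k m T
  have h2 := hn₀ n hnn
  have h3 := hk (m + 1) hmk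
  rw [Real.dist_eq, sub_zero, abs_of_nonneg (integral_nonneg fun _ => norm_nonneg _)] at h2 ⊢
  rw [Real.dist_eq, sub_zero, abs_of_nonneg (integral_nonneg fun _ => translateDist_nonneg _ _),
    lt_div_iff₀ (by positivity)] at h3
  simp only [hA, hn, Real.norm_eq_abs] at h2 ⊢
  -- The type of the block depends on `TP T`, which must become a variable before it can be
  -- substituted.
  generalize TP T = p at hm ⊢
  subst hm
  have h4 : 0 ≤ ∫ ω, translateDist f (β₀ ^ (m + 1) * X 0 ω) ∂μ :=
    integral_nonneg fun _ => translateDist_nonneg _ _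
  nlinarith

end AR1Model
end

/-! ## Rates of the sample split -/

section Rates

/-- Once the ratio of square roots exceeds `1 / 2`, `TE T` is at least `T / 4`. -/
theorem SplitRates.tendsto_atTop {l : ℕ → ℝ} {TE TP : ℕ → ℕ}
    (h : SplitRates (fun T => √(T : ℝ)) l TE TP) : Tendsto TE atTop atTop := by
  rw [← tendsto_natCast_atTop_iff (R := ℝ)]
  refine tendsto_atTop_mono' _ ?_
    ((tendsto_natCast_atTop_atTop (R := ℝ)).atTop_div_const (show (0 : ℝ) < 4 by norm_num))
  filter_upwards [h.estimation.eventually (lt_mem_nhds (show (1 / 2 : ℝ) < 1 by norm_num)),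
    eventually_gt_atTop 0] with T hT hT0
  have hs : 0 < √(T : ℝ) := Real.sqrt_pos.2 (by exact_mod_cast hT0)
  rw [lt_div_iff₀ hs] at hT
  have h1 := Real.sq_sqrt (Nat.cast_nonneg (α := ℝ) T)
  have h2 := Real.sq_sqrt (Nat.cast_nonneg (α := ℝ) (TE T))
  nlinarith

theorem eventually_floor_rpow_lt {a b : ℝ} (ha : 0 < a) (hab : a < b) (hb : b < 1) :
    ∀ᶠ T : ℕ in atTop, ⌊(T : ℝ) ^ a⌋₊ < ⌊(T : ℝ) ^ b⌋₊ ∧ ⌊(T : ℝ) ^ b⌋₊ ≤ T := by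
  have h1 := ((tendsto_rpow_atTop (sub_pos.2 hab)).comp
    (tendsto_natCast_atTop_atTop (R := ℝ))).eventually_ge_atTop 2
  filter_upwards [h1, eventually_ge_atTop 1] with T hT hT1
  have hT1' : (1 : ℝ) ≤ T := by exact_mod_cast hT1
  have h2 : 1 ≤ (T : ℝ) ^ a := Real.one_le_rpow hT1' ha.le
  constructor
  · rw [Nat.lt_iff_add_one_le, ← Nat.floor_add_one (by positivity)]
    refine Nat.floor_mono ?_
    have : (T : ℝ) ^ b = (T : ℝ) ^ a * (T : ℝ) ^ (b - a) := by
      rw [← Real.rpow_add (by linarith)]; congr 1; ring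
    rw [this]
    simp only [Function.comp_apply] at hT
    nlinarith
  · refine Nat.floor_le_of_le ?_
    simpa using Real.rpow_le_rpow_of_exponent_le hT1' hb.le

/-- The floor is at least `T^a / 2` and `log T ≤ (2 / a) T^(a/2)`, so the ratio is at least `(a / 4)
T^(a/2)`. -/
theorem tendsto_floor_rpow_div_log {a : ℝ} (ha : 0 < a) :
    Tendsto (fun T : ℕ => (⌊(T : ℝ) ^ a⌋₊ : ℝ) / Real.log T) atTop atTop := by
  refine tendsto_atTop_mono' _ ?_ (((tendsto_rpow_atTop (half_pos ha)).comp
    (tendsto_natCast_atTop_atTop (R := ℝ))).const_mul_atTop (show 0 < a / 4 by positivity))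
  filter_upwards [eventually_ge_atTop 2] with T hT
  have hT' : (2 : ℝ) ≤ T := by exact_mod_cast hT
  have hlog : 0 < Real.log T := Real.log_pos (by linarith)
  rw [le_div_iff₀ hlog]
  have h1 := Real.log_le_rpow_div (show (0 : ℝ) ≤ T by linarith) (half_pos ha)
  have h2 : 1 ≤ (T : ℝ) ^ a := Real.one_le_rpow (by linarith) ha.le
  have h3 : (1 : ℝ) ≤ ⌊(T : ℝ) ^ a⌋₊ := by exact_mod_cast Nat.le_floor (n := 1) (by simpa using h2)
  have h4 := Nat.lt_floor_add_one ((T : ℝ) ^ a)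
  have h5 : (T : ℝ) ^ a = (T : ℝ) ^ (a / 2) * (T : ℝ) ^ (a / 2) := by
    rw [← Real.rpow_add (by linarith)]; congr 1; ring
  rw [le_div_iff₀ (half_pos ha)] at h1
  have h6 : 0 ≤ (T : ℝ) ^ (a / 2) := by positivity
  simp only [Function.comp_apply]
  nlinarith [mul_le_mul_of_nonneg_left h1 h6]

theorem tendsto_floor_rpow_div {b : ℝ} (hb : b < 1) :
    Tendsto (fun T : ℕ => (⌊(T : ℝ) ^ b⌋₊ : ℝ) / T) atTop (𝓝 0) := by
  refine tendsto_of_tendsto_of_tendsto_of_le_of_le' tendsto_const_nhds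
    ((tendsto_rpow_neg_atTop (sub_pos.2 hb)).comp (tendsto_natCast_atTop_atTop (R := ℝ)))
    (Eventually.of_forall fun T => by positivity) ?_
  filter_upwards [eventually_ge_atTop 1] with T hT
  have hT' : (0 : ℝ) < T := by exact_mod_cast hT
  rw [div_le_iff₀ hT', Function.comp_apply, ← Real.rpow_add_one hT'.ne']
  refine (Nat.floor_le (by positivity)).trans_eq ?_
  congr 1; ring

theorem exists_splitRates {a b : ℝ} (ha : 0 < a) (hab : a < b) (hb : b < 1) :
    ∃ TE TP : ℕ → ℕ,
      (∀ᶠ T : ℕ in atTop, TE T = T - ⌊(T : ℝ) ^ b⌋₊) ∧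
      (∀ᶠ T : ℕ in atTop, TP T = T - ⌊(T : ℝ) ^ a⌋₊) ∧
      SplitRates (fun T => √(T : ℝ)) (fun T => Real.log T) TE TP := by
  have hev := eventually_floor_rpow_lt ha hab hb
  set P : ℕ → Prop := fun T => ⌊(T : ℝ) ^ a⌋₊ < ⌊(T : ℝ) ^ b⌋₊ ∧ ⌊(T : ℝ) ^ b⌋₊ ≤ T with hP
  classical
  -- The values `0` and `1` at the remaining `T` are there because `TE T < TP T` is required for
  -- every `T`.
  refine ⟨fun T => if P T then T - ⌊(T : ℝ) ^ b⌋₊ else 0,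
    fun T => if P T then T - ⌊(T : ℝ) ^ a⌋₊ else 1, ?_, ?_, ?_, ?_, ?_⟩
  · filter_upwards [hev] with T hT
    exact if_pos hT
  · filter_upwards [hev] with T hT
    exact if_pos hT
  · intro T
    split_ifs with h
    · obtain ⟨h1, h2⟩ := h
      omega
    · exact one_pos
  · refine (tendsto_floor_rpow_div_log ha).congr' ?_
    filter_upwards [hev] with T hT
    rw [if_pos hT, Nat.cast_sub (hT.1.le.trans hT.2), sub_sub_cancel]
  · have h1 : Tendsto (fun T : ℕ => √(1 - (⌊(T : ℝ) ^ b⌋₊ : ℝ) / T)) atTop (𝓝 1) := by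
      simpa using ((tendsto_floor_rpow_div hb).const_sub 1).sqrt
    refine h1.congr' ?_
    filter_upwards [hev, eventually_ge_atTop 1] with T hT hT1
    have hT' : (0 : ℝ) < T := by exact_mod_cast hT1
    rw [if_pos hT, Nat.cast_sub hT.2, ← Real.sqrt_div' _ hT'.le, sub_div, div_self hT'.ne']

end Rates

/-! ## Centred Gaussian laws as functions of their variance -/

section Gaussian

/-- Scaling one fixed Gaussian makes continuity in the variance a matter of dominated convergence,
including at zero. For negative `v` the convention `√v = 0` agrees with the truncation. -/
theorem gaussianReal_toNNReal_eq_map (v : ℝ) :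
    gaussianReal 0 v.toNNReal = (gaussianReal 0 1).map fun x => √v * x := by
  rw [gaussianReal_map_const_mul, mul_zero, mul_one]
  congr 1
  ext
  change (v.toNNReal : ℝ) = √v ^ 2
  rcases le_total 0 v with h | h
  · rw [Real.sq_sqrt h, Real.coe_toNNReal _ h]
  · rw [Real.sqrt_eq_zero_of_nonpos h, Real.toNNReal_of_nonpos h]; simp

theorem measurable_gaussianReal_toNNReal :
    Measurable fun v : ℝ => gaussianReal 0 v.toNNReal :=
  measurable_gaussianReal.comp (measurable_const.prodMk measurable_real_toNNReal)

theorem continuous_integral_gaussianReal_toNNReal {h : ℝ → ℝ} (hh : Continuous h) {C : ℝ}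
    (hC : ∀ x, |h x| ≤ C) :
    Continuous fun v : ℝ => ∫ y, h y ∂(gaussianReal 0 v.toNNReal) := by
  have e : (fun v : ℝ => ∫ y, h y ∂(gaussianReal 0 v.toNNReal))
      = fun v => ∫ x, h (√v * x) ∂(gaussianReal 0 1) := by
    ext v
    rw [gaussianReal_toNNReal_eq_map,
      integral_map (by fun_prop) hh.measurable.aestronglyMeasurable]
  rw [e]
  exact continuous_of_dominated (bound := fun _ => C)
    (fun v => (hh.comp (by fun_prop)).aestronglyMeasurable) (fun v => ae_of_all _ fun x => hC _)
    (integrable_const _) (ae_of_all _ fun x => hh.comp (by fun_prop))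

end Gaussian

/-! ## Transfer along measure-preserving maps -/

section Transfer

theorem _root_.MeasureTheory.MeasurePreserving.map_comp_eq {α β γ : Type*} [MeasurableSpace α]
    [MeasurableSpace β] [MeasurableSpace γ] {μ : Measure α} {ν : Measure β} {π : α → β}
    (hπ : MeasurePreserving π μ ν) {f : β → γ} (hf : Measurable f) :
    μ.map (f ∘ π) = ν.map f := by
  rw [← Measure.map_map hf hπ.measurable, hπ.map_eq]

theorem _root_.MeasureTheory.MeasurePreserving.iIndepFun_comp {α β ι : Type*} [MeasurableSpace α]
    [MeasurableSpace β] {μ : Measure α} [IsProbabilityMeasure μ] {ν : Measure β}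
    [IsProbabilityMeasure ν] {π : α → β} (hπ : MeasurePreserving π μ ν) {E : ι → Type*}
    [∀ i, MeasurableSpace (E i)] {f : ∀ i, β → E i} (hf : ∀ i, Measurable (f i))
    (h : iIndepFun f ν) : iIndepFun (fun i => f i ∘ π) μ := by
  rw [iIndepFun_iff_map_fun_eq_infinitePi_map hf] at h
  rw [iIndepFun_iff_map_fun_eq_infinitePi_map fun i => (hf i).comp hπ.measurable]
  simp only [hπ.map_comp_eq (hf _)]
  rw [← h]
  exact hπ.map_comp_eq (measurable_pi_iff.2 hf)

/-- Apart from measurability and the conditions on `Θ`, the model involves only laws, integrals and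
null sets, all preserved by `π`. -/
theorem AR1Model.comp_measurePreserving {Ω Ω' : Type*} [MeasurableSpace Ω] [MeasurableSpace Ω']
    {μ : Measure Ω} [IsProbabilityMeasure μ] {μ' : Measure Ω'} [IsProbabilityMeasure μ']
    {Θ : Set ℝ} {β₀ : ℝ} {ε X : ℤ → Ω → ℝ} (hX : AR1Model μ Θ β₀ ε X) {π : Ω' → Ω}
    (hπ : MeasurePreserving π μ' μ) :
    AR1Model μ' Θ β₀ (fun t => ε t ∘ π) (fun t => X t ∘ π) where
  compact := hX.compact
  mem_interior := hX.mem_interior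
  abs_lt_one := hX.abs_lt_one
  innov_measurable t := (hX.innov_measurable t).comp hπ.measurable
  innov_indep := hπ.iIndepFun_comp hX.innov_measurable hX.innov_indep
  innov_identDistrib t :=
    ⟨((hX.innov_measurable t).comp hπ.measurable).aemeasurable,
      ((hX.innov_measurable 0).comp hπ.measurable).aemeasurable, by
      rw [hπ.map_comp_eq (hX.innov_measurable t), hπ.map_comp_eq (hX.innov_measurable 0),
        (hX.innov_identDistrib t).map_eq]⟩
  innov_density := by
    rw [hπ.map_comp_eq (hX.innov_measurable 0)]
    exact hX.innov_density
  innov_mean := by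
    have h := integral_map hπ.measurable.aemeasurable
      (hX.innov_measurable 0).aestronglyMeasurable (μ := μ')
    rw [hπ.map_eq, hX.innov_mean] at h
    exact h.symm
  innov_fourth_moment :=
    (hπ.integrable_comp ((hX.innov_measurable 0).pow_const 4).aestronglyMeasurable).2
      hX.innov_fourth_moment
  measurable t := (hX.measurable t).comp hπ.measurable
  recursion t := hπ.quasiMeasurePreserving.ae (hX.recursion t)
  causal := by
    obtain ⟨ϑ, h1, h2⟩ := hX.causal
    exact ⟨ϑ, h1, fun t => hπ.quasiMeasurePreserving.ae (h2 t)⟩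

/-- On the square of the probability space the first coordinate carries the model and the second its
copy. -/
theorem AR1Model.exists_independent_copy {Ω : Type u} [MeasurableSpace Ω]
    {μ : Measure Ω} [IsProbabilityMeasure μ] {Θ : Set ℝ} {β₀ : ℝ} {ε X : ℤ → Ω → ℝ}
    (hX : AR1Model μ Θ β₀ ε X) :
    ∃ (Ω' : Type u) (_ : MeasurableSpace Ω') (μ' : Measure Ω') (_ : IsProbabilityMeasure μ')
      (π : Ω' → Ω) (Y : ℤ → Ω' → ℝ), MeasurePreserving π μ' μ ∧
        AR1Model μ' Θ β₀ (fun t => ε t ∘ π) (fun t => X t ∘ π) ∧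
        TwoIndependentProcesses μ' (fun t => X t ∘ π) Y := by
  have h1 : MeasurePreserving (Prod.fst : Ω × Ω → Ω) (μ.prod μ) μ := measurePreserving_fst
  have h2 : MeasurePreserving (Prod.snd : Ω × Ω → Ω) (μ.prod μ) μ := measurePreserving_snd
  have hm : Measurable fun ω t => X t ω := measurable_pi_iff.2 hX.measurable
  refine ⟨Ω × Ω, inferInstance, μ.prod μ, inferInstance, Prod.fst, fun t => X t ∘ Prod.snd, h1,
    hX.comp_measurePreserving h1, fun t => (hX.measurable t).comp measurable_snd, ?_, ?_⟩
  · exact ⟨(hm.comp measurable_snd).aemeasurable, (hm.comp measurable_fst).aemeasurable,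
      (h2.map_comp_eq hm).trans (h1.map_comp_eq hm).symm⟩
  · exact (indepFun_prod hm hm).symm

end Transfer

/-! ## The assumptions in the autoregressive model -/

section OrderSymbols

variable {Ω : Type u} [MeasurableSpace Ω] {μ : Measure Ω}

theorem isBigOp_zero : IsBigOp μ fun _ _ => 0 := fun _ _ => ⟨0, by simp⟩

theorem isLittleOp_of_eventually_eq_zero {Z : ℕ → Ω → ℝ≥0∞} (h : ∀ᶠ T in atTop, ∀ ω, Z T ω = 0) :
    IsLittleOp μ Z := fun η hη => by
  refine tendsto_const_nhds.congr' ?_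
  filter_upwards [h] with T hT
  simp [hT, hη.ne']

theorem isBigOp_of_identDistrib [IsProbabilityMeasure μ] {Z : ℕ → Ω → ℝ} {W : Ω → ℝ}
    (hW : Measurable W) (h : ∀ T, IdentDistrib (Z T) W μ μ) :
    IsBigOp μ fun T ω => ‖Z T ω‖ₑ := by
  intro δ hδ
  have hS : ∀ n : ℕ, MeasurableSet {x : ℝ | ((n : ℝ≥0) : ℝ≥0∞) < ‖x‖ₑ} := fun n =>
    measurableSet_lt measurable_const measurable_enorm
  have ht := tendsto_measure_iInter_atTop (μ := μ)
    (s := fun n : ℕ => W ⁻¹' {x : ℝ | ((n : ℝ≥0) : ℝ≥0∞) < ‖x‖ₑ})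
    (fun n => (hW (hS n)).nullMeasurableSet)
    (fun n m hnm => Set.preimage_mono (Set.ofPred_subset_ofPred.2 fun x hx =>
      lt_of_le_of_lt (ENNReal.coe_le_coe.2 (Nat.cast_le.2 hnm)) hx)) ⟨0, measure_ne_top _ _⟩
  have he : ⋂ n : ℕ, W ⁻¹' {x : ℝ | ((n : ℝ≥0) : ℝ≥0∞) < ‖x‖ₑ} = ∅ := by
    refine Set.eq_empty_of_forall_notMem fun ω hω => ?_
    obtain ⟨n, hn⟩ := exists_nat_ge ‖W ω‖₊
    have := Set.mem_iInter.1 hω n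
    simp only [Set.mem_preimage, Set.mem_ofPred_eq, enorm_eq_nnnorm, ENNReal.coe_lt_coe] at this
    exact absurd hn (not_le.2 this)
  rw [he, measure_empty] at ht
  obtain ⟨n, hn⟩ := (ht.eventually (ge_mem_nhds hδ)).exists
  refine ⟨n, Eventually.of_forall fun T => ?_⟩
  exact ((h T).measure_mem_eq (hS n)).trans_le hn

/-- All `Z T` share the law of `W`, and `P(W < 1 / (n + 1))` decreases to `P(W ≤ 0) = 0`. -/
theorem boundedAwayFromZeroInProb_of_identDistrib [IsProbabilityMeasure μ] {Z : ℕ → Ω → ℝ}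
    {W : Ω → ℝ} (hW : Measurable W) (h : ∀ T, IdentDistrib (Z T) W μ μ)
    (hpos : ∀ᵐ ω ∂μ, 0 < W ω) : BoundedAwayFromZeroInProb μ Z := by
  intro δ hδ
  have ht := tendsto_measure_iInter_atTop (μ := μ)
    (s := fun n : ℕ => W ⁻¹' Set.Iio (1 / ((n : ℝ) + 1)))
    (fun n => (hW measurableSet_Iio).nullMeasurableSet)
    (fun n m hnm => Set.preimage_mono (Set.Iio_subset_Iio (Nat.one_div_le_one_div hnm))) ⟨0, measure_ne_top _ _⟩
  have he : μ (⋂ n : ℕ, W ⁻¹' Set.Iio (1 / ((n : ℝ) + 1))) = 0 := by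
    refine measure_mono_null (fun ω hω => ?_) (ae_iff.1 hpos)
    intro h0
    obtain ⟨n, hn⟩ := exists_nat_one_div_lt h0
    exact lt_asymm hn (Set.mem_iInter.1 hω n)
  rw [he] at ht
  obtain ⟨n, hn⟩ := (ht.eventually (ge_mem_nhds (ENNReal.ofReal_pos.2 hδ))).exists
  refine ⟨1 / ((n : ℝ) + 1), by positivity, Eventually.of_forall fun T => ?_⟩
  have h1 : μ.real (W ⁻¹' Set.Iio (1 / ((n : ℝ) + 1))) ≤ δ :=
    ENNReal.toReal_le_of_le_ofReal hδ.le hn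
  have h2 : μ.real {ω | 1 / ((n : ℝ) + 1) ≤ Z T ω} = μ.real (W ⁻¹' Set.Ici (1 / ((n : ℝ) + 1))) :=
    congrArg ENNReal.toReal ((h T).measure_mem_eq measurableSet_Ici)
  rw [h2, ← Set.compl_Iio, Set.preimage_compl, probReal_compl_eq_one_sub (hW measurableSet_Iio)]
  linarith

/-- A factor that converges in probability to a positive constant is harmless. -/
theorem BoundedAwayFromZeroInProb.mul_tendstoInMeasure [IsProbabilityMeasure μ]
    {Z V : ℕ → Ω → ℝ} (hZ : BoundedAwayFromZeroInProb μ Z) {v : ℝ} (hv : 0 < v)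
    (hV : TendstoInMeasure μ V atTop fun _ => v) :
    BoundedAwayFromZeroInProb μ fun T ω => Z T ω * V T ω := by
  intro δ hδ
  obtain ⟨η, hη, h1⟩ := hZ (δ / 2) (half_pos hδ)
  have h2 := hV (ENNReal.ofReal (v / 2)) (ENNReal.ofReal_pos.2 (half_pos hv))
  refine ⟨η * (v / 2), by positivity, ?_⟩
  filter_upwards [h1, h2.eventually (ge_mem_nhds (ENNReal.ofReal_pos.2 (half_pos hδ)))]
    with T hT1 hT2
  have h3 := ENNReal.toReal_le_of_le_ofReal (half_pos hδ).le hT2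
  have hsub : {ω | η ≤ Z T ω} ⊆ {ω | η * (v / 2) ≤ Z T ω * V T ω} ∪
      {ω | ENNReal.ofReal (v / 2) ≤ edist (V T ω) v} := by
    intro ω hω
    by_contra hcon
    simp only [Set.mem_union, Set.mem_ofPred_eq, not_or, not_le, edist_dist] at hcon
    obtain ⟨hc1, hc2⟩ := hcon
    rw [ENNReal.ofReal_lt_ofReal_iff (half_pos hv), Real.dist_eq, abs_lt] at hc2
    have : η ≤ Z T ω := hω
    nlinarith
  have h4 := (measureReal_mono (μ := μ) hsub).trans (measureReal_union_le _ _)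
  change μ.real _ ≤ _ at h3
  linarith

end OrderSymbols

theorem deriv_ar1Mean (x : ℕ → ℝ) : deriv (ar1Mean x) = fun _ => x 0 := by
  ext β
  exact ((hasDerivAt_id β).mul_const (x 0)).deriv.trans (one_mul _)

theorem iteratedDeriv_two_ar1Mean (x : ℕ → ℝ) (β : ℝ) : iteratedDeriv 2 (ar1Mean x) β = 0 := by
  rw [iteratedDeriv_succ, iteratedDeriv_one, deriv_ar1Mean, deriv_const]

theorem measurable_olsVariance (T : ℕ) : Measurable (olsVariance T) :=
  ((measurable_olsEstimator T).pow_const 2).const_sub 1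

namespace AR1Model

variable {Ω : Type u} [MeasurableSpace Ω] {μ : Measure Ω} [IsProbabilityMeasure μ]
  {Θ : Set ℝ} {β₀ : ℝ} {ε X : ℤ → Ω → ℝ}

theorem generalAssumptions (hX : AR1Model μ Θ β₀ ε X) (s c : ℤ → ℝ) :
    GeneralAssumptions μ X Θ β₀ ar1Mean olsEstimator
      (fun T => √(T : ℝ)) (fun T => Real.log T) (gaussianReal 0 (1 - β₀ ^ 2).toNNReal) s c where
  mem := interior_subset hX.mem_interior
  m_tendsto := Real.tendsto_sqrt_atTop.comp tendsto_natCast_atTop_atTop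
  l_tendsto := Real.tendsto_log_atTop.comp tendsto_natCast_atTop_atTop
  estimator := hX.tendstoInDistribution_olsError
  continuousOn x := (continuous_id.mul continuous_const).continuousOn
  differentiableOn x := (differentiable_id.mul_const _).differentiableOn
  twice_differentiableOn x := by
    rw [deriv_ar1Mean]
    exact differentiableOn_const _
  gradient := by
    simp only [deriv_ar1Mean, past]
    exact isBigOp_of_identDistrib (hX.measurable 0) fun T => hX.identDistrib _
  hessian_and_initial := by
    refine ⟨interior Θ, isOpen_interior, hX.mem_interior, interior_subset, ?_,
      fun t₁ _ ht₁ => ?_⟩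
    · simp only [iteratedDeriv_two_ar1Mean, enorm_zero, ENNReal.iSup_zero]
      exact isBigOp_zero
    -- A positive quotient over `log T ≥ 0` forces `t₁ T < T`, so entry `0`, the only one that
    -- `ar1Mean` reads, is `X_T` in both pasts. The first two differences then vanish identically;
    -- the third does so for every `T`, both second derivatives being zero.
    have hev : ∀ᶠ T : ℕ in atTop, ∀ ω, approxPast X s c (t₁ T) T ω 0 = past X T ω 0 := by
      filter_upwards [ht₁.eventually_gt_atTop 0, eventually_ge_atTop 1] with T hT hT1 ω
      have hlog : 0 ≤ Real.log T := Real.log_natCast_nonneg T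
      have hle : (t₁ T : ℝ) ≤ T := by
        by_contra hcon
        exact absurd hT (not_lt.2 (div_nonpos_of_nonpos_of_nonneg (by linarith) hlog))
      have hle' : (t₁ T : ℤ) ≤ T := by exact_mod_cast hle
      simp [approxPast, past, hle']
    refine ⟨isLittleOp_of_eventually_eq_zero ?_, isLittleOp_of_eventually_eq_zero ?_,
      isLittleOp_of_eventually_eq_zero (Eventually.of_forall fun T ω => ?_)⟩
    · filter_upwards [hev] with T hT ω
      simp [ar1Mean, hT]
    · filter_upwards [hev] with T hT ω
      simp [deriv_ar1Mean, hT]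
    · simp [iteratedDeriv_two_ar1Mean]

theorem one_sub_sq_coeff_pos (hX : AR1Model μ Θ β₀ ε X) : 0 < 1 - β₀ ^ 2 :=
  sub_pos.2 hX.coeff_sq_lt_one

theorem tendstoInMeasure_olsVariance (hX : AR1Model μ Θ β₀ ε X) :
    TendstoInMeasure μ (fun T ω => olsVariance T (sample X T ω)) atTop fun _ => 1 - β₀ ^ 2 :=
  tendstoInMeasure_comp_continuousAt hX.tendstoInMeasure_olsEstimator
    (g := fun x => 1 - x ^ 2) (by fun_prop)

theorem cdfEstimatorAssumption (hX : AR1Model μ Θ β₀ ε X) :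
    CdfEstimatorAssumption μ X olsLaw (gaussianReal 0 (1 - β₀ ^ 2).toNNReal) where
  measurable T := measurable_gaussianReal_toNNReal.comp (measurable_olsVariance T)
  isProbabilityMeasure T x := by rw [olsLaw]; infer_instance
  tendsto := by
    rintro h ⟨⟨C, hC⟩, K, hK⟩
    exact tendstoInMeasure_comp_continuousAt hX.tendstoInMeasure_olsVariance
      (continuous_integral_gaussianReal_toNNReal hK.continuous hC).continuousAt

theorem normalityAssumption (hX : AR1Model μ Θ β₀ ε X) :
    NormalityAssumption μ X (gaussianReal 0 (1 - β₀ ^ 2).toNNReal) (1 - β₀ ^ 2).toNNReal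
      olsVariance where
  normal := rfl
  measurable := measurable_olsVariance
  tendsto := by
    rw [Real.coe_toNNReal _ hX.one_sub_sq_coeff_pos.le]
    exact hX.tendstoInMeasure_olsVariance

theorem boundedAwayFromZeroInProb_sq (hX : AR1Model μ Θ β₀ ε X) :
    BoundedAwayFromZeroInProb μ fun T ω => X T ω ^ 2 := by
  refine boundedAwayFromZeroInProb_of_identDistrib ((hX.measurable 0).pow_const 2)
    (fun T => (hX.identDistrib T).comp (measurable_id.pow_const 2)) ?_
  rw [ae_iff]
  refine measure_mono_null (fun ω hω => ?_) (hX.measure_eq_zero 0 0)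
  by_contra h0
  exact hω (sq_pos_of_ne_zero h0)

theorem boundedAwayFromZeroInProb_sq_mul_olsVariance (hX : AR1Model μ Θ β₀ ε X) {N : ℕ → ℕ}
    (hN : Tendsto N atTop atTop) :
    BoundedAwayFromZeroInProb μ fun T ω => X T ω ^ 2 * olsVariance (N T) (sample X (N T) ω) :=
  hX.boundedAwayFromZeroInProb_sq.mul_tendstoInMeasure hX.one_sub_sq_coeff_pos
    fun ε hε => (hX.tendstoInMeasure_olsVariance ε hε).comp hN

end AR1Model

end TimeSeriesPrediction

open TimeSeriesPrediction in
theorem mainTheorem4 {Ω : Type u} [MeasurableSpace Ω] (μ : Measure Ω) [IsProbabilityMeasure μ]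
    (Θ : Set ℝ) (β₀ : ℝ) (ε X : ℤ → Ω → ℝ) (hX : AR1Model μ Θ β₀ ε X) :
    -- general assumptions, for arbitrary starting values `s` and constants `c`
    (∀ s c : ℤ → ℝ, GeneralAssumptions μ X Θ β₀ ar1Mean olsEstimator
      (fun T => √(T : ℝ)) (fun T => Real.log T) (gaussianReal 0 (1 - β₀ ^ 2).toNNReal) s c) ∧
    -- an independent copy exists after enlarging the probability space
    (∃ (Ω' : Type u) (_ : MeasurableSpace Ω') (μ' : Measure Ω') (_ : IsProbabilityMeasure μ')
      (π : Ω' → Ω) (Y : ℤ → Ω' → ℝ), MeasurePreserving π μ' μ ∧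
        AR1Model μ' Θ β₀ (fun t => ε t ∘ π) (fun t => X t ∘ π) ∧
        TwoIndependentProcesses μ' (fun t => X t ∘ π) Y) ∧
    -- the rates are met by `TE = T - ⌊T^b⌋` and `TP = T - ⌊T^a⌋` (for large `T`)
    (∀ a b : ℝ, 0 < a → a < b → b < 1 → ∃ TE TP : ℕ → ℕ,
      (∀ᶠ T : ℕ in atTop, TE T = T - ⌊(T : ℝ) ^ b⌋₊) ∧
      (∀ᶠ T : ℕ in atTop, TP T = T - ⌊(T : ℝ) ^ a⌋₊) ∧
      SplitRates (fun T => √(T : ℝ)) (fun T => Real.log T) TE TP) ∧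
    -- all sample-split assumptions hold for every choice that meets the rates
    (∀ TE TP : ℕ → ℕ, SplitRates (fun T => √(T : ℝ)) (fun T => Real.log T) TE TP →
      SplitEstimatorAssumptions μ X β₀ olsEstimator
        (fun T => √(T : ℝ)) (fun T => Real.log T) TE TP) ∧
    -- estimation of the limit law, and normality
    CdfEstimatorAssumption μ X olsLaw (gaussianReal 0 (1 - β₀ ^ 2).toNNReal) ∧
    NormalityAssumption μ X (gaussianReal 0 (1 - β₀ ^ 2).toNNReal) (1 - β₀ ^ 2).toNNReal
      olsVariance ∧
    -- the (stationary) law of `X_t` is continuous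
    (∀ (t : ℤ) (x : ℝ), μ {ω | X t ω = x} = 0) ∧
    -- the estimated variances are bounded away from zero in probability
    BoundedAwayFromZeroInProb μ
      (fun T ω => X T ω ^ 2 * olsVariance T (sample X T ω)) ∧
    (∀ TE TP : ℕ → ℕ, SplitRates (fun T => √(T : ℝ)) (fun T => Real.log T) TE TP →
      BoundedAwayFromZeroInProb μ
        (fun T ω => X T ω ^ 2 * olsVariance (TE T) (sample X (TE T) ω))) :=
  ⟨hX.generalAssumptions, hX.exists_independent_copy, fun _ _ => exists_splitRates,
    fun _ _ h => ⟨h, hX.strictlyStationary, hX.weakDependence h.lt h.tendsto_atTop⟩,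
    hX.cdfEstimatorAssumption, hX.normalityAssumption, hX.measure_eq_zero,
    hX.boundedAwayFromZeroInProb_sq_mul_olsVariance tendsto_id,
    fun _ _ h => hX.boundedAwayFromZeroInProb_sq_mul_olsVariance h.tendsto_atTop⟩
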